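/- For a positive integer $d$, a distance-$d$ packing of two cycles in a graph $G$ is a pair of distinct cycles $C_1, C_2$ of $G$ such that $G$ has no path of length at most $d$ (paths of length $0$ included) with one end in $C_1$ and the other in $C_2$. There are an absolute constant $c$, a polynomial $p$, and a deterministic algorithm (a program on a random access machine with unit-cost addition and subtraction and without multiplication) such that the following holds for all positive integers $d$ and $t$ and every finite simple graph $G$ of maximum degree at most $t$. Given $G$ (by its adjacency matrix) and $d$, the algorithm halts after at most $p(|V(G)|)$ steps and outputs either a distance-$d$ packing of two cycles in $G$, or a set $X$ of at most $c\cdot d\cdot t^{2d}$ vertices of $G$ such that $G-X$ is a forest. -/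

import Mathlib

namespace CoarseErdosPosa

/-! ### Graph notions -/

/-- A subgraph of `G` is a cycle if it consists of the vertices and edges of a closed walk that
repeats neither an edge nor a vertex (other than its endpoint). -/
def IsCycleSubgraph {V : Type*} {G : SimpleGraph V} (C : G.Subgraph) : Prop :=
  ∃ (u : V) (w : G.Walk u u), w.IsCycle ∧ w.toSubgraph = C

/-- A set `F` of cycles of `G` is a distance-`d` packing if `G` has no path of length at most `d`
between any two distinct cycles in `F`. (Paths of length `0` count, so distinct cycles of a packing
are vertex-disjoint.) -/
def IsDistancePacking {V : Type*} (G : SimpleGraph V) (d : ℕ) (F : Set G.Subgraph) : Prop :=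
  (∀ C ∈ F, IsCycleSubgraph C) ∧
    ∀ C ∈ F, ∀ D ∈ F, C ≠ D →
      ∀ u ∈ C.verts, ∀ v ∈ D.verts, ∀ p : G.Walk u v, p.IsPath → ¬ p.length ≤ d

/-- `X` is a feedback vertex set of `G`: the graph `G - X` is a forest. -/
def IsFeedbackVertexSet {V : Type*} (G : SimpleGraph V) (X : Set V) : Prop :=
  (G.induce Xᶜ).IsAcyclic

/-! ### The machine model

A random access machine with finitely many named registers and arrays holding natural numbers, run
by structured programs. The only arithmetic operations are addition and truncated subtraction, each
of unit cost; there is no multiplication, so in `T` steps the bit length of the stored numbers grows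
by at most `O(T)`. Hence polynomial time on this machine is ordinary polynomial time. -/

/-- A memory state: registers `reg x`, and arrays `arr a` with cells `arr a i`. -/
structure Memory where
  reg : ℕ → ℕ
  arr : ℕ → ℕ → ℕ

/-- Expressions: constants, registers, array cells at a computed index, `+` and truncated `-`. -/
inductive Expr where
  | const (k : ℕ)
  | reg (x : ℕ)
  | cell (a : ℕ) (i : Expr)
  | add (e f : Expr)
  | sub (e f : Expr)

/-- The value of an expression. -/
def Expr.eval (s : Memory) : Expr → ℕ
  | .const k => k
  | .reg x => s.reg x
  | .cell a i => s.arr a (i.eval s)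
  | .add e f => e.eval s + f.eval s
  | .sub e f => e.eval s - f.eval s

/-- The number of steps needed to evaluate an expression: one for each operation in it. -/
def Expr.cost : Expr → ℕ
  | .const _ => 1
  | .reg _ => 1
  | .cell _ i => i.cost + 1
  | .add e f => e.cost + f.cost + 1
  | .sub e f => e.cost + f.cost + 1

/-- Programs. A test `e` succeeds if the value of `e` is nonzero. -/
inductive Program where
  | skip
  /-- store the value of `e` in register `x` -/
  | assign (x : ℕ) (e : Expr)
  /-- store the value of `e` in cell `i` of array `a` -/
  | write (a : ℕ) (i e : Expr)
  | seq (P Q : Program)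
  | ite (e : Expr) (P Q : Program)
  | loop (e : Expr) (P : Program)

/-- `Runs P s T s'`: started in memory `s`, the program `P` halts after exactly `T` steps, with
memory `s'`. -/
inductive Runs : Program → Memory → ℕ → Memory → Prop where
  | skip (s : Memory) : Runs .skip s 1 s
  | assign (s : Memory) (x : ℕ) (e : Expr) :
      Runs (.assign x e) s (e.cost + 1) ⟨Function.update s.reg x (e.eval s), s.arr⟩
  | write (s : Memory) (a : ℕ) (i e : Expr) :
      Runs (.write a i e) s (i.cost + e.cost + 1)
        ⟨s.reg, Function.update s.arr a (Function.update (s.arr a) (i.eval s) (e.eval s))⟩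
  | seq {P Q : Program} {s s' s'' : Memory} {T T' : ℕ} :
      Runs P s T s' → Runs Q s' T' s'' → Runs (.seq P Q) s (T + T') s''
  | ite_true {e : Expr} {P Q : Program} {s s' : Memory} {T : ℕ} :
      e.eval s ≠ 0 → Runs P s T s' → Runs (.ite e P Q) s (e.cost + 1 + T) s'
  | ite_false {e : Expr} {P Q : Program} {s s' : Memory} {T : ℕ} :
      e.eval s = 0 → Runs Q s T s' → Runs (.ite e P Q) s (e.cost + 1 + T) s'
  | loop_done {e : Expr} {P : Program} {s : Memory} :
      e.eval s = 0 → Runs (.loop e P) s (e.cost + 1) s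
  | loop_step {e : Expr} {P : Program} {s s' s'' : Memory} {T T' : ℕ} :
      e.eval s ≠ 0 → Runs P s T s' → Runs (.loop e P) s' T' s'' →
        Runs (.loop e P) s (e.cost + 1 + T + T') s''

/-- The machine is deterministic: final memory and number of steps are determined by the program and
the initial memory. -/
theorem Runs.deterministic {P : Program} {s s' s'' : Memory} {T T' : ℕ} (h : Runs P s T s')
    (h' : Runs P s T' s'') : T = T' ∧ s' = s'' := by
  induction h generalizing T' s'' with
  | skip => cases h'; simp
  | assign => cases h'; simp
  | write => cases h'; simp
  | seq _ _ i1 i2 =>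
    cases h' with
    | seq a b => obtain ⟨rfl, rfl⟩ := i1 a; obtain ⟨rfl, rfl⟩ := i2 b; simp
  | ite_true e _ i =>
    cases h' with
    | ite_true _ a => obtain ⟨rfl, rfl⟩ := i a; simp
    | ite_false a _ => exact absurd a e
  | ite_false e _ i =>
    cases h' with
    | ite_false _ a => obtain ⟨rfl, rfl⟩ := i a; simp
    | ite_true a _ => exact absurd e a
  | loop_done e =>
    cases h' with
    | loop_done => simp
    | loop_step a => exact absurd e a
  | loop_step e _ _ i1 i2 =>
    cases h' with
    | loop_done a => exact absurd a e
    | loop_step _ a b => obtain ⟨rfl, rfl⟩ := i1 a; obtain ⟨rfl, rfl⟩ := i2 b; simp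

/-! ### Input and output formats -/

/-- The initial memory on input `(G, d)`, where `G` is a graph on `{0, …, n - 1}`: register `0` holds
`n`, register `1` holds `d`, array `0` holds the adjacency matrix of `G` row by row, and everything
else is `0`. -/
def inputMemory {n : ℕ} (G : SimpleGraph (Fin n)) [DecidableRel G.Adj] (d : ℕ) : Memory where
  reg x := if x = 0 then n else if x = 1 then d else 0
  arr a m := if a = 0 ∧ ∃ i j : Fin n, m = (i : ℕ) * n + (j : ℕ) ∧ G.Adj i j then 1 else 0

/-- The list stored in array `a`, with its length stored in register `a`. -/
def Memory.list (s : Memory) (a : ℕ) : List ℕ :=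
  (List.range (s.reg a)).map (s.arr a)

/-- The memory `s` outputs the cycle `C` in array `a`: the list stored there is the sequence of
vertices of `C` in cyclic order, starting and ending at the same vertex. -/
def OutputsCycle {n : ℕ} {G : SimpleGraph (Fin n)} (s : Memory) (a : ℕ) (C : G.Subgraph) : Prop :=
  ∃ (u : Fin n) (w : G.Walk u u), w.IsCycle ∧ w.toSubgraph = C ∧
    w.support.map (fun v => (v : ℕ)) = s.list a

/-- The memory `s` outputs the vertex set `X` in array `a`: the list stored there enumerates the
elements of `X`, without repetition. -/
def OutputsSet {n : ℕ} (s : Memory) (a : ℕ) (X : Finset (Fin n)) : Prop :=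
  ∃ l : List (Fin n), l.Nodup ∧ l.toFinset = X ∧ l.map (fun v => (v : ℕ)) = s.list a

/-- Register `0` is `1`, and arrays `1` and `2` contain two distinct cycles of `G` that form a
distance-`d` packing. -/
def OutputsPacking {n : ℕ} (G : SimpleGraph (Fin n)) (d : ℕ) (s : Memory) : Prop :=
  s.reg 0 = 1 ∧ ∃ C D : G.Subgraph, C ≠ D ∧ IsDistancePacking G d {C, D} ∧
    OutputsCycle s 1 C ∧ OutputsCycle s 2 D

/-- Register `0` is `0`, and array `1` contains a feedback vertex set of `G` of size at most `b`. -/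
def OutputsFeedbackVertexSet {n : ℕ} (G : SimpleGraph (Fin n)) (b : ℕ) (s : Memory) : Prop :=
  s.reg 0 = 0 ∧ ∃ X : Finset (Fin n), X.card ≤ b ∧ IsFeedbackVertexSet G (X : Set (Fin n)) ∧
    OutputsSet s 1 X

end CoarseErdosPosa

/-!
Deleting vertices of degree at most one repeatedly leaves the core of `G`. Give a vertex with at
least three neighbours in the core the weight `n`, any other vertex the weight `1`, and let `C` be a
lightest cycle of the core. A cycle that avoids the ball of radius `d` around `C` forms a packing
with `C`. If there is none, then `C` has at most `4 d + 12` branch vertices: if some core vertex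
lies outside `C`, then `C` has an ear of weight at most `n (2 d + 5)`, which together with the
lighter arc of `C` between its ends contains a cycle that is not lighter than `C`; otherwise a chord
takes the place of the ear. A short path from `C` to another cycle leaves `C` at a branch vertex, so
the ball of radius `d` around the branch vertices of `C` and one further vertex of `C` meets every
cycle. It has at most `(4 d + 13) t ^ (2 d)` vertices.
-/

namespace CoarseErdosPosa

/-! ### Programs with bounded loops -/

/-- The memory `s` with `v` stored in register `x`. -/
def setReg (s : Memory) (x v : ℕ) : Memory := ⟨Function.update s.reg x v, s.arr⟩

/-- The memory `s` with `v` stored in cell `i` of array `a`. -/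
def setCell (s : Memory) (a i v : ℕ) : Memory :=
  ⟨s.reg, Function.update s.arr a (Function.update (s.arr a) i v)⟩

@[simp] theorem reg_setReg (s : Memory) (x v y : ℕ) :
    (setReg s x v).reg y = if y = x then v else s.reg y := by
  simp [setReg, Function.update_apply]

@[simp] theorem arr_setReg (s : Memory) (x v : ℕ) : (setReg s x v).arr = s.arr := rfl

@[simp] theorem reg_setCell (s : Memory) (a i v : ℕ) : (setCell s a i v).reg = s.reg := rfl

@[simp] theorem arr_setCell (s : Memory) (a i v b : ℕ) :
    (setCell s a i v).arr b = if b = a then Function.update (s.arr a) i v else s.arr b := by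
  simp only [setCell, Function.update_apply]

namespace Expr

/-- The test `e` succeeds in memory `s`. -/
def Holds (e : Expr) (s : Memory) : Prop := e.eval s ≠ 0

instance (e : Expr) (s : Memory) : Decidable (e.Holds s) := inferInstanceAs (Decidable (_ ≠ _))

/-- The test `e < f`. -/
def lt (e f : Expr) : Expr := .sub f e

/-- The test `e ≠ f`. -/
def ne (e f : Expr) : Expr := .add (.sub e f) (.sub f e)

/-- The disjunction of two tests. -/
def or (e f : Expr) : Expr := .add e f

/-- The negation of a test. -/
def not (e : Expr) : Expr := .sub (.const 1) e

/-- The conjunction of two tests. -/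
def and (e f : Expr) : Expr := not (or (not e) (not f))

variable {e f : Expr} {s : Memory}

@[simp] theorem holds_reg (x : ℕ) : (Expr.reg x).Holds s ↔ s.reg x ≠ 0 := Iff.rfl

@[simp] theorem holds_cell (a : ℕ) (i : Expr) :
    (Expr.cell a i).Holds s ↔ s.arr a (i.eval s) ≠ 0 := Iff.rfl

@[simp] theorem holds_lt : (lt e f).Holds s ↔ e.eval s < f.eval s := Nat.sub_ne_zero_iff_lt

@[simp] theorem holds_ne : (ne e f).Holds s ↔ e.eval s ≠ f.eval s := by
  simp only [Holds, ne, eval]; omega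

@[simp] theorem holds_or : (or e f).Holds s ↔ e.Holds s ∨ f.Holds s := by
  simp only [Holds, or, eval]; omega

@[simp] theorem holds_not : (not e).Holds s ↔ ¬ e.Holds s := by
  simp only [Holds, not, eval]; omega

@[simp] theorem holds_and : (and e f).Holds s ↔ e.Holds s ∧ f.Holds s := by
  simp only [and, holds_not, holds_or]; tauto

end Expr

/-- Programs with bounded loops: `forRange i P` runs `P` with register `i` equal to `0, …, n - 1`,
where `n` is the value of register `0`. -/
inductive ForProgram where
  | skip
  | assign (x : ℕ) (e : Expr)
  | write (a : ℕ) (i e : Expr)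
  | seq (P Q : ForProgram)
  | ite (e : Expr) (P Q : ForProgram)
  | forRange (i : ℕ) (P : ForProgram)

namespace ForProgram

/-- The machine program for a program with bounded loops. -/
def compile : ForProgram → Program
  | skip => .skip
  | assign x e => .assign x e
  | write a i e => .write a i e
  | seq P Q => .seq P.compile Q.compile
  | ite e P Q => .ite e P.compile Q.compile
  | forRange i P => .seq (.assign i (.const 0)) (.loop (.sub (.reg 0) (.reg i))
      (.seq P.compile (.assign i (.add (.reg i) (.const 1)))))

/-- The memory after `k` rounds of a loop with index register `i`, whose body acts by `f`. -/
def rounds (i : ℕ) (f : Memory → Memory) (s : Memory) : ℕ → Memory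
  | 0 => s
  | k + 1 => f (setReg (rounds i f s k) i k)

/-- The final memory of a program with bounded loops. -/
def denote : ForProgram → Memory → Memory
  | skip, s => s
  | assign x e, s => setReg s x (e.eval s)
  | write a i e, s => setCell s a (i.eval s) (e.eval s)
  | seq P Q, s => Q.denote (P.denote s)
  | ite e P Q, s => if e.Holds s then P.denote s else Q.denote s
  | forRange i P, s => setReg (rounds i P.denote s (s.reg 0)) i (s.reg 0)

/-- The registers that a program may change. -/
def regs : ForProgram → List ℕ
  | skip => []
  | assign x _ => [x]
  | write _ _ _ => []
  | seq P Q => P.regs ++ Q.regs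
  | ite _ P Q => P.regs ++ Q.regs
  | forRange i P => i :: P.regs

/-- The arrays that a program may change. -/
def arrs : ForProgram → List ℕ
  | skip => []
  | assign _ _ => []
  | write a _ _ => [a]
  | seq P Q => P.arrs ++ Q.arrs
  | ite _ P Q => P.arrs ++ Q.arrs
  | forRange _ P => P.arrs

/-- No loop of the program changes its own index. -/
def indexSafe : ForProgram → Bool
  | skip => true
  | assign _ _ => true
  | write _ _ _ => true
  | seq P Q => P.indexSafe && Q.indexSafe
  | ite _ P Q => P.indexSafe && Q.indexSafe
  | forRange i P => P.indexSafe && decide (i ∉ P.regs)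

/-- A bound for the running time, as a polynomial in the value of register `0`. -/
noncomputable def cost : ForProgram → Polynomial ℕ
  | skip => 1
  | assign _ e => .C (e.cost + 1)
  | write _ i e => .C (i.cost + e.cost + 1)
  | seq P Q => P.cost + Q.cost
  | ite e P Q => .C (e.cost + 1) + P.cost + Q.cost
  | forRange _ P => .X * (P.cost + .C 8) + .C 8

/-- The memories `s` and `s'` differ only where `P` may change them. -/
structure Frame (P : ForProgram) (s s' : Memory) : Prop where
  reg : ∀ r, r ∉ P.regs → s'.reg r = s.reg r
  arr : ∀ a, a ∉ P.arrs → s'.arr a = s.arr a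

theorem Frame.refl (P : ForProgram) (s : Memory) : P.Frame s s :=
  ⟨fun _ _ => rfl, fun _ _ => rfl⟩

theorem Frame.trans {P : ForProgram} {s s' s'' : Memory} (h : P.Frame s s') (h' : P.Frame s' s'') :
    P.Frame s s'' :=
  ⟨fun r hr => (h'.reg r hr).trans (h.reg r hr), fun a ha => (h'.arr a ha).trans (h.arr a ha)⟩

theorem Frame.mono {P Q : ForProgram} {s s' : Memory} (h : P.Frame s s') (hr : P.regs ⊆ Q.regs)
    (ha : P.arrs ⊆ Q.arrs) : Q.Frame s s' :=
  ⟨fun r h' => h.reg r (mt (@hr r) h'), fun a h' => h.arr a (mt (@ha a) h')⟩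

theorem frame_setReg {P : ForProgram} {x : ℕ} (hx : x ∈ P.regs) (s : Memory) (v : ℕ) :
    P.Frame s (setReg s x v) :=
  ⟨fun r hr => by rw [reg_setReg, if_neg]; rintro rfl; exact hr hx, fun _ _ => rfl⟩

theorem frame_rounds {i : ℕ} {P : ForProgram} (h : ∀ s, P.Frame s (P.denote s)) (s : Memory)
    (k : ℕ) : (forRange i P).Frame s (rounds i P.denote s k) := by
  induction k with
  | zero => exact .refl _ _
  | succ k ih =>
    exact (ih.trans (frame_setReg (by simp [regs]) _ _)).trans
      ((h _).mono (List.subset_cons_self _ _) (List.Subset.refl _))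

theorem frame_denote (P : ForProgram) (s : Memory) : P.Frame s (P.denote s) := by
  induction P generalizing s with
  | skip => exact .refl _ _
  | assign x e => exact frame_setReg (by simp [regs]) _ _
  | write a i e =>
    exact ⟨fun _ _ => rfl, fun b hb => by simp [denote, show b ≠ a by simpa [arrs] using hb]⟩
  | seq P Q ihP ihQ =>
    exact ((ihP s).mono (by simp [regs]) (by simp [arrs])).trans
      ((ihQ _).mono (by simp [regs]) (by simp [arrs]))
  | ite e P Q ihP ihQ =>
    rw [denote]
    split_ifs
    · exact (ihP s).mono (by simp [regs]) (by simp [arrs])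
    · exact (ihQ s).mono (by simp [regs]) (by simp [arrs])
  | forRange i P ih => exact (frame_rounds ih s _).trans (frame_setReg (by simp [regs]) _ _)

theorem reg_denote {P : ForProgram} {r : ℕ} (h : r ∉ P.regs) (s : Memory) :
    (P.denote s).reg r = s.reg r :=
  (frame_denote P s).reg r h

theorem arr_denote {P : ForProgram} {a : ℕ} (h : a ∉ P.arrs) (s : Memory) :
    (P.denote s).arr a = s.arr a :=
  (frame_denote P s).arr a h

theorem runs_loop {i : ℕ} {P : ForProgram} (hi : i ∉ P.regs) (h0 : 0 ∉ (forRange i P).regs)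
    (hP : ∀ s, ∃ T, Runs P.compile s T (P.denote s) ∧ T ≤ P.cost.eval (s.reg 0)) (s : Memory)
    (m k : ℕ) (hk : k + m = s.reg 0) :
    ∃ T, Runs (.loop (.sub (.reg 0) (.reg i))
        (.seq P.compile (.assign i (.add (.reg i) (.const 1)))))
        (setReg (rounds i P.denote s k) i k) T ((forRange i P).denote s) ∧
      T ≤ m * (P.cost.eval (s.reg 0) + 8) + 4 := by
  have h0i : 0 ≠ i := fun h => h0 (by simp [regs, h])
  have hn (k : ℕ) : (setReg (rounds i P.denote s k) i k).reg 0 = s.reg 0 := by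
    rw [reg_setReg, if_neg h0i, (frame_rounds (frame_denote P) s k).reg 0 h0]
  induction m generalizing k with
  | zero =>
    obtain rfl : k = s.reg 0 := by omega
    exact ⟨_, .loop_done (by simp only [Expr.eval, hn]; simp), by simp [Expr.cost]⟩
  | succ m ihm =>
    obtain ⟨T, hT, hTle⟩ := ihm (k + 1) (by omega)
    obtain ⟨T', hT', hTle'⟩ := hP (setReg (rounds i P.denote s k) i k)
    have hnext : (⟨Function.update (P.denote (setReg (rounds i P.denote s k) i k)).reg i
        ((Expr.add (.reg i) (.const 1)).eval (P.denote (setReg (rounds i P.denote s k) i k))),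
        (P.denote (setReg (rounds i P.denote s k) i k)).arr⟩ : Memory) =
          setReg (rounds i P.denote s (k + 1)) i (k + 1) := by
      rw [Expr.eval, Expr.eval, Expr.eval, reg_denote hi, reg_setReg, if_pos rfl]; rfl
    refine ⟨_, .loop_step ?_ (.seq hT' (.assign _ _ _)) (hnext ▸ hT), ?_⟩
    · simp only [Expr.eval, hn, reg_setReg, if_true]; omega
    · rw [hn] at hTle'
      simp only [Expr.cost]
      nlinarith

theorem runs_compile (P : ForProgram) (hP : P.indexSafe = true) (h0 : 0 ∉ P.regs) (s : Memory) :
    ∃ T, Runs P.compile s T (P.denote s) ∧ T ≤ P.cost.eval (s.reg 0) := by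
  induction P generalizing s with
  | skip => exact ⟨1, .skip s, by simp [cost]⟩
  | assign x e => exact ⟨_, .assign s x e, by simp [cost]⟩
  | write a i e => exact ⟨_, .write s a i e, by simp only [cost, Polynomial.eval_C]; exact le_rfl⟩
  | seq P Q ihP ihQ =>
    simp only [regs, List.mem_append, not_or] at h0
    simp only [indexSafe, Bool.and_eq_true] at hP
    obtain ⟨T, h, hT⟩ := ihP hP.1 h0.1 s
    obtain ⟨T', h', hT'⟩ := ihQ hP.2 h0.2 (P.denote s)
    rw [reg_denote h0.1] at hT'
    exact ⟨_, .seq h h', by simp only [cost, Polynomial.eval_add]; omega⟩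
  | ite e P Q ihP ihQ =>
    simp only [regs, List.mem_append, not_or] at h0
    simp only [indexSafe, Bool.and_eq_true] at hP
    obtain ⟨T, h, hT⟩ := ihP hP.1 h0.1 s
    obtain ⟨T', h', hT'⟩ := ihQ hP.2 h0.2 s
    simp only [cost, Polynomial.eval_add, Polynomial.eval_C]
    by_cases he : e.Holds s
    · exact ⟨_, by rw [denote, if_pos he]; exact .ite_true he h, by omega⟩
    · exact ⟨_, by rw [denote, if_neg he]; exact .ite_false (not_not.1 he) h', by omega⟩
  | forRange i P ih =>
    simp only [indexSafe, Bool.and_eq_true, decide_eq_true_eq] at hP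
    have hP0 : 0 ∉ P.regs := fun h => h0 (List.mem_cons_of_mem _ h)
    obtain ⟨T, hT, hTle⟩ := runs_loop hP.2 h0 (ih hP.1 hP0) s (s.reg 0) 0 (by omega)
    refine ⟨_, .seq (.assign _ _ _) hT, ?_⟩
    simp only [Expr.cost, cost, Polynomial.eval_add, Polynomial.eval_mul, Polynomial.eval_X,
      Polynomial.eval_C]
    omega

theorem forRange_induction {n i : ℕ} {P : ForProgram} {s : Memory} (hn : s.reg 0 = n)
    (I : ℕ → Memory → Prop) (hset : ∀ k s' v, I k s' → I k (setReg s' i v)) (h0 : I 0 s)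
    (hstep : ∀ (x : Fin n) (s' : Memory), (forRange i P).Frame s s' → s'.reg i = x → I x s' →
      I (x + 1) (P.denote s')) :
    I n ((forRange i P).denote s) := by
  suffices h : ∀ k ≤ n, I k (rounds i P.denote s k) by
    rw [denote, hn]; exact hset _ _ _ (h n le_rfl)
  intro k hk
  induction k with
  | zero => exact h0
  | succ k ih =>
    exact hstep ⟨k, by omega⟩ _
      ((frame_rounds (frame_denote P) s k).trans (frame_setReg (by simp [regs]) _ _)) (by simp)
      (hset _ _ _ (ih (by omega)))

end ForProgram

/-- The function on the vertices stored in array `a`. -/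
def values (n : ℕ) (s : Memory) (a : ℕ) : Fin n → ℕ := fun x => s.arr a x

/-- The vertex set whose indicator function is stored in array `a`. -/
def mask (n : ℕ) (s : Memory) (a : ℕ) : Finset (Fin n) := {x | s.arr a x ≠ 0}

@[simp] theorem mem_mask {n : ℕ} {s : Memory} {a : ℕ} {x : Fin n} :
    x ∈ mask n s a ↔ s.arr a x ≠ 0 := by
  simp [mask]

theorem values_setCell {n : ℕ} (s : Memory) (a : ℕ) (x : Fin n) (v : ℕ) :
    values n (setCell s a x v) a = Function.update (values n s a) x v := by
  ext y
  simp [values, Function.update_apply, Fin.ext_iff]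

theorem ForProgram.Frame.values_eq {P : ForProgram} {s s' : Memory} {n a : ℕ} (h : P.Frame s s')
    (ha : a ∉ P.arrs) : values n s' a = values n s a :=
  funext fun x => congrFun (h.arr a ha) x

theorem ForProgram.Frame.mask_eq {P : ForProgram} {s s' : Memory} {n a : ℕ} (h : P.Frame s s')
    (ha : a ∉ P.arrs) : mask n s' a = mask n s a := by
  simp only [mask, h.arr a ha]

theorem card_filter_lt_succ {n : ℕ} (T : Fin n → Prop) [DecidablePred T] (k : Fin n) :
    ({x | T x ∧ x.val < k + 1} : Finset (Fin n)).card =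
      ({x | T x ∧ x.val < k} : Finset (Fin n)).card + if T k then 1 else 0 := by
  have hlt (x : Fin n) : x.val < k + 1 ↔ x = k ∨ x.val < k := by rw [Fin.ext_iff]; omega
  split_ifs with hk
  · rw [← Finset.card_insert_of_notMem (a := k) (by simp)]
    congr 1
    ext x
    simp only [Finset.mem_filter_univ, Finset.mem_insert, hlt]
    constructor
    · tauto
    · rintro (rfl | h) <;> tauto
  · rw [add_zero]
    congr 1
    ext x
    simp only [Finset.mem_filter_univ, hlt]
    constructor
    · rintro ⟨h, rfl | h'⟩ <;> tauto
    · tauto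

/-- `OutputsCycle` and `OutputsSet` coerce a list of vertices through the list monad. -/
theorem map_coe_list {n : ℕ} (l : List (Fin n)) :
    ((do let a ← l; pure (a : ℕ)) : List ℕ).map (fun v => v) = l.map fun v : Fin n => (v : ℕ) := by
  induction l with
  | nil => rfl
  | cons a l ih => simpa using ih

theorem Memory.list_push (s : Memory) (a v : ℕ) :
    (setReg (setCell s a (s.reg a) v) a (s.reg a + 1)).list a = s.list a ++ [v] := by
  simp only [Memory.list, reg_setReg, if_true, List.range_succ, List.map_append, arr_setReg,
    arr_setCell, List.map_cons, List.map_nil, Function.update_self]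
  congr 1
  refine List.map_congr_left fun k hk => ?_
  rw [Function.update_of_ne (List.mem_range.1 hk).ne]

namespace ForProgram

/-- Count in register `c` the values of register `i` that pass the test `e`. -/
def countIf (c i : ℕ) (e : Expr) : ForProgram :=
  .seq (.assign c (.const 0)) (.forRange i (.ite e (.assign c (.add (.reg c) (.const 1))) .skip))

/-- Store in register `r` the last value of register `i` that passes the test `e`. -/
def findLast (r i : ℕ) (e : Expr) : ForProgram :=
  .forRange i (.ite e (.assign r (.reg i)) .skip)

/-- List in array `a` the values of register `i` that pass the test `e`. -/
def collect (a i : ℕ) (e : Expr) : ForProgram :=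
  .seq (.assign a (.const 0)) (.forRange i (.ite e
    (.seq (.write a (.reg a) (.reg i)) (.assign a (.add (.reg a) (.const 1)))) .skip))

variable {n i a c r : ℕ} {e : Expr} {P : ForProgram} {s : Memory}

theorem cells_forRange (hn : s.reg 0 = n) (R : Fin n → ℕ → Prop)
    (hstep : ∀ (x : Fin n) (s' : Memory), (forRange i P).Frame s s' → s'.reg i = x →
      ∃ v, R x v ∧ (P.denote s').arr a = Function.update (s'.arr a) x v) (x : Fin n) :
    R x (((forRange i P).denote s).arr a x) := by
  have h := forRange_induction (i := i) (P := P) hn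
    (fun k s' => ∀ x : Fin n, x.val < k → R x (s'.arr a x)) (fun _ _ _ h => h) (by simp)
    (fun x s' hF hx h y hy => by
      obtain ⟨v, hv, heq⟩ := hstep x s' hF hx
      rw [heq, Function.update_apply]
      split_ifs with hyx
      · rwa [Fin.ext hyx]
      · exact h y (by omega))
  exact h x x.2

theorem mask_forRange (hn : s.reg 0 = n) (T : Finset (Fin n))
    (hT : ∀ (x : Fin n) (s' : Memory), (forRange i (.write a (.reg i) e)).Frame s s' →
      s'.reg i = x → (e.Holds s' ↔ x ∈ T)) :
    mask n ((forRange i (.write a (.reg i) e)).denote s) a = T :=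
  Finset.ext fun x => mem_mask.trans <| cells_forRange hn (fun x v => v ≠ 0 ↔ x ∈ T)
    (fun x s' hF hx => ⟨_, hT x s' hF hx, by simp [denote, Expr.eval, hx]⟩) x

theorem reg_countIf (hn : s.reg 0 = n) (hci : c ≠ i) (hc : c ≠ 0) (T : Fin n → Prop)
    [DecidablePred T] (hT : ∀ (x : Fin n) (s' : Memory), (countIf c i e).Frame s s' →
      s'.reg i = x → (e.Holds s' ↔ T x)) :
    ((countIf c i e).denote s).reg c = ({x | T x} : Finset (Fin n)).card := by
  have h := forRange_induction (i := i) (P := .ite e (.assign c (.add (.reg c) (.const 1))) .skip)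
    (n := n) (s := setReg s c 0) (by rwa [reg_setReg, if_neg hc.symm])
    (fun k s' => s'.reg c = ({x | T x ∧ x.val < k} : Finset (Fin n)).card)
    (fun k s' x h => by simpa [hci] using h) (by simp)
    (fun x s' hF hx h => by
      have hTx := hT x s' ((frame_setReg (by simp [countIf, regs]) s 0).trans
        (hF.mono (by simp [countIf, regs]) (by simp [countIf, arrs]))) hx
      rw [denote, card_filter_lt_succ T x]
      split_ifs with h1 h2 h2
      · simp [denote, Expr.eval, h]
      · exact absurd (hTx.1 h1) h2
      · exact absurd (hTx.2 h2) h1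
      · exact h)
  simpa only [countIf, denote, Expr.eval, Fin.is_lt, and_true] using h

theorem exists_reg_findLast (hn : s.reg 0 = n) (hri : r ≠ i) (T : Fin n → Prop)
    (hT : ∀ (x : Fin n) (s' : Memory), (findLast r i e).Frame s s' → s'.reg i = x →
      (e.Holds s' ↔ T x)) (hex : ∃ x, T x) :
    ∃ x, T x ∧ ((findLast r i e).denote s).reg r = x := by
  have h := forRange_induction (i := i) (P := .ite e (.assign r (.reg i)) .skip) hn
    (fun k s' => (∃ x : Fin n, x.val < k ∧ T x) → ∃ x : Fin n, T x ∧ s'.reg r = x)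
    (fun k s' v h hk => by simpa [hri] using h hk) (by simp)
    (fun x s' hF hx h => by
      rintro ⟨y, hyx, hy⟩
      rw [denote]
      split_ifs with he
      · exact ⟨x, (hT x s' hF hx).1 he, by simp [denote, Expr.eval, hx]⟩
      · refine h ⟨y, lt_of_le_of_ne (Nat.lt_succ_iff.1 hyx) fun hval => ?_, hy⟩
        exact he ((hT x s' hF hx).2 (Fin.ext hval ▸ hy)))
  obtain ⟨x, hx⟩ := hex
  exact h ⟨x, x.2, hx⟩

theorem outputsSet_collect (hn : s.reg 0 = n) (hai : a ≠ i) (ha : a ≠ 0) (T : Finset (Fin n))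
    (hT : ∀ (x : Fin n) (s' : Memory), (collect a i e).Frame s s' → s'.reg i = x →
      (e.Holds s' ↔ x ∈ T)) :
    OutputsSet ((collect a i e).denote s) a T := by
  have h := forRange_induction (i := i) (P := .ite e
      (.seq (.write a (.reg a) (.reg i)) (.assign a (.add (.reg a) (.const 1)))) .skip)
    (n := n) (s := setReg s a 0) (by rwa [reg_setReg, if_neg ha.symm])
    (fun k s' => ∃ l : List (Fin n), l.Nodup ∧ (∀ x, x ∈ l ↔ x ∈ T ∧ x.val < k) ∧
      l.map (fun v : Fin n => (v : ℕ)) = s'.list a)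
    (fun k s' x h => by simpa [Memory.list, hai] using h) ⟨[], by simp [Memory.list]⟩
    (fun x s' hF hx ⟨l, hnodup, hmem, hl⟩ => by
      have hTx := hT x s' ((frame_setReg (by simp [collect, regs]) s 0).trans
        (hF.mono (by simp [collect, regs]) (by simp [collect, arrs]))) hx
      rw [denote]
      split_ifs with he
      · refine ⟨l ++ [x], by simpa using hnodup.concat (a := x) (by simp [hmem]), fun y => ?_, ?_⟩
        · rw [List.mem_append, List.mem_singleton, hmem, Nat.lt_succ_iff_lt_or_eq, ← Fin.ext_iff]
          have := hTx.1 he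
          constructor
          · rintro (h | rfl) <;> tauto
          · tauto
        · simp only [denote, Expr.eval, hx, reg_setCell, Memory.list_push]
          simp [hl]
      · refine ⟨l, hnodup, fun y => ?_, hl⟩
        rw [hmem, Nat.lt_succ_iff_lt_or_eq, ← Fin.ext_iff]
        constructor
        · tauto
        · rintro ⟨hy, h | rfl⟩
          · exact ⟨hy, h⟩
          · exact absurd (hTx.2 hy) he)
  obtain ⟨l, hnodup, hmem, hl⟩ := h
  exact ⟨l, hnodup, Finset.ext fun x => by simp [hmem], (map_coe_list l).trans hl⟩

theorem isLeast_forRange (hn : s.reg 0 = n) (hri : r ≠ i) (J : Memory → Prop)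
    (hset : ∀ s' v, J s' → J (setReg s' i v)) (h0 : J s) (A : Fin n → Set ℕ)
    (hstep : ∀ (x : Fin n) (s' : Memory), (forRange i P).Frame s s' → s'.reg i = x → J s' →
      s'.reg r ≤ s.reg r →
        J (P.denote s') ∧ IsLeast (insert (s'.reg r) (A x)) ((P.denote s').reg r)) :
    J ((forRange i P).denote s) ∧
      IsLeast (insert (s.reg r) (⋃ x, A x)) (((forRange i P).denote s).reg r) := by
  have h := forRange_induction (i := i) (P := P) hn
    (fun k s' => J s' ∧
      IsLeast (insert (s.reg r) {b | ∃ x : Fin n, x.val < k ∧ b ∈ A x}) (s'.reg r))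
    (fun k s' v h => ⟨hset s' v h.1, by simpa [hri] using h.2⟩) ⟨h0, by simp⟩
    (fun x s' hF hx ⟨hJ, hmem, hle⟩ => by
      obtain ⟨hJ', hmem', hle'⟩ := hstep x s' hF hx hJ (hle (Set.mem_insert _ _))
      refine ⟨hJ', ?_, ?_⟩
      · rcases hmem' with h | h
        · rw [h]
          exact hmem.imp_right fun ⟨y, hy, hb⟩ => ⟨y, hy.trans (Nat.lt_succ_self _), hb⟩
        · exact Or.inr ⟨x, Nat.lt_succ_self _, h⟩
      · have hnew : (P.denote s').reg r ≤ s'.reg r := hle' (Set.mem_insert _ _)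
        rintro b (rfl | ⟨y, hy, hb⟩)
        · exact hnew.trans (hle (Set.mem_insert _ _))
        · rcases Nat.lt_succ_iff_lt_or_eq.1 hy with hy | hy
          · exact hnew.trans (hle (Or.inr ⟨y, hy, hb⟩))
          · exact hle' (Or.inr (Fin.ext hy ▸ hb)))
  refine ⟨h.1, ?_⟩
  convert h.2 using 2
  exact Set.ext fun b => by simp

end ForProgram

/-! ### Vertex sets of minimum degree two -/

section HasMinDegTwo

variable {V : Type*} {H : SimpleGraph V}

/-- The subgraph of `H` induced by `U` has minimum degree at least two. Such sets replace cycles in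
all optimization problems below: the vertex set of a cycle is one, and each nonempty one contains
the vertex set of a cycle. -/
def HasMinDegTwo (H : SimpleGraph V) (U : Finset V) : Prop :=
  ∀ x ∈ U, ∃ y ∈ U, ∃ z ∈ U, y ≠ z ∧ H.Adj x y ∧ H.Adj x z

/-- The spanning subgraph of `H` with all edges inside `K`. -/
def restrict (H : SimpleGraph V) (K : Finset V) : SimpleGraph V :=
  ((⊤ : H.Subgraph).induce K).spanningCoe

@[simp] theorem restrict_adj {K : Finset V} {x y : V} :
    (restrict H K).Adj x y ↔ H.Adj x y ∧ x ∈ K ∧ y ∈ K := by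
  simp [restrict]; tauto

theorem HasMinDegTwo.mono {H' : SimpleGraph V} {U : Finset V} (hU : HasMinDegTwo H U)
    (h : ∀ x ∈ U, ∀ y ∈ U, H.Adj x y → H'.Adj x y) : HasMinDegTwo H' U := by
  intro x hx
  obtain ⟨y, hy, z, hz, hyz, hxy, hxz⟩ := hU x hx
  exact ⟨y, hy, z, hz, hyz, h x hx y hy hxy, h x hx z hz hxz⟩

theorem HasMinDegTwo.mem_of_restrict {K U : Finset V} (hU : HasMinDegTwo (restrict H K) U) {x : V}
    (hx : x ∈ U) : x ∈ K := by
  obtain ⟨y, -, -, -, -, hxy, -⟩ := hU x hx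
  exact (restrict_adj.1 hxy).2.1

theorem HasMinDegTwo.of_restrict {K U : Finset V} (hU : HasMinDegTwo (restrict H K) U) :
    HasMinDegTwo H U :=
  hU.mono fun _ _ _ _ h => (restrict_adj.1 h).1

theorem hasMinDegTwo_support [DecidableEq V] {u : V} {p : H.Walk u u} (hp : p.IsCycle) :
    HasMinDegTwo H p.support.toFinset := by
  intro x hx
  rw [List.mem_toFinset] at hx
  have hc := hp.rotate hx
  have hmem (k : ℕ) : (p.rotate x hx).getVert k ∈ p.support.toFinset :=
    List.mem_toFinset.2
      ((p.mem_support_rotate_iff x hx).1 (SimpleGraph.Walk.getVert_mem_support ..))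
  exact ⟨_, hmem _, _, hmem _, hc.snd_ne_penultimate, SimpleGraph.Walk.adj_snd hc.not_nil,
    (SimpleGraph.Walk.adj_penultimate hc.not_nil).symm⟩

theorem exists_hasMinDegTwo_of_walk [DecidableEq V] {x y : V} (h : H.Adj x y) (p : H.Walk x y)
    (hp : s(x, y) ∉ p.edges) :
    ∃ U ⊆ p.support.toFinset, U.Nonempty ∧ HasMinDegTwo H U := by
  have hreach :
      (restrict H p.support.toFinset \ SimpleGraph.fromEdgeSet {s(x, y)}).Reachable x y := by
    refine ⟨p.transfer _ fun e he => ?_⟩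
    induction e with | h a b => ?_
    simp only [SimpleGraph.mem_edgeSet, SimpleGraph.sdiff_adj, SimpleGraph.fromEdgeSet_adj,
      restrict_adj, List.mem_toFinset]
    refine ⟨⟨p.adj_of_mem_edges he, p.fst_mem_support_of_mem_edges he,
      p.snd_mem_support_of_mem_edges he⟩, fun hab => hp ?_⟩
    rwa [← Set.mem_singleton_iff.1 hab.1]
  obtain ⟨u, c, hc, -⟩ := SimpleGraph.adj_and_reachable_delete_edges_iff_exists_cycle.1
    ⟨restrict_adj.2 ⟨h, by simp⟩, hreach⟩
  have hU := hasMinDegTwo_support hc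
  exact ⟨_, fun z hz => hU.mem_of_restrict hz, ⟨u, by simp⟩, hU.of_restrict⟩

theorem exists_isCycle_of_injOn {g : ℕ → V} {k : ℕ} (hk : 3 ≤ k)
    (hadj : ∀ l < k, H.Adj (g l) (g (l + 1))) (hclosed : g k = g 0)
    (hinj : Set.InjOn g (Set.Ioc 0 k)) :
    ∃ p : H.Walk (g 0) (g 0), p.IsCycle ∧ p.support = (List.range (k + 1)).map g := by
  have hwalk (m : ℕ) (hm : m ≤ k) :
      ∃ p : H.Walk (g 0) (g m), p.support = (List.range (m + 1)).map g := by
    induction m with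
    | zero => exact ⟨.nil, by simp⟩
    | succ m ih =>
      obtain ⟨p, hp⟩ := ih (by omega)
      refine ⟨p.concat (hadj m hm), ?_⟩
      rw [SimpleGraph.Walk.support_concat, hp, List.range_succ (n := m + 1), List.map_append]
      simp
  obtain ⟨p, hp⟩ := hwalk k le_rfl
  have hlen : p.length = k := by simpa using congrArg List.length hp
  have hsupp : (p.copy rfl hclosed).support = (List.range (k + 1)).map g := by simpa using hp
  refine ⟨p.copy rfl hclosed, ?_, hsupp⟩
  rw [SimpleGraph.Walk.isCycle_iff_isPath_tail_and_le_length, SimpleGraph.Walk.isPath_def,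
    SimpleGraph.Walk.support_tail_of_not_nil _
      (by rw [← SimpleGraph.Walk.length_eq_zero_iff, SimpleGraph.Walk.length_copy]; omega),
    hsupp, List.range_succ_eq_map, List.map_cons, List.tail_cons, List.map_map]
  refine ⟨List.Nodup.map_on (fun a ha b hb hab => ?_) List.nodup_range, by simpa [hlen] using hk⟩
  rw [List.mem_range] at ha hb
  exact Nat.succ_injective (hinj ⟨a.succ_pos, ha⟩ ⟨b.succ_pos, hb⟩ hab)

/-- The sequence `f 0, …, f m` follows edges of `H` inside `U` and never turns back. -/
structure IsNonbacktracking (H : SimpleGraph V) (U : Finset V) (m : ℕ) (f : ℕ → V) : Prop where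
  mem : ∀ l ≤ m, f l ∈ U
  adj : ∀ l < m, H.Adj (f l) (f (l + 1))
  ne : ∀ l, l + 2 ≤ m → f (l + 2) ≠ f l

theorem IsNonbacktracking.update {U : Finset V} {m : ℕ} {f : ℕ → V}
    (hf : IsNonbacktracking H U m f) {x : V} (hx : x ∈ U) (hadj : H.Adj (f m) x)
    (hne : x ≠ f (m - 1)) : IsNonbacktracking H U (m + 1) (Function.update f (m + 1) x) where
  mem l hl := by
    rcases hl.eq_or_lt with rfl | hl
    · simpa
    · rw [Function.update_of_ne hl.ne]; exact hf.mem l (by omega)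
  adj l hl := by
    rw [Function.update_of_ne hl.ne]
    rcases Nat.lt_succ_iff_lt_or_eq.1 hl with hl | rfl
    · rw [Function.update_of_ne (by omega)]; exact hf.adj l hl
    · simpa
  ne l hl := by
    rw [Function.update_of_ne (a := l) (by omega)]
    rcases hl.eq_or_lt with hl | hl
    · obtain rfl : m = l + 1 := by omega
      simpa using hne
    · rw [Function.update_of_ne (by omega)]; exact hf.ne l (by omega)

/-- A shortest interval between repetitions of a non-backtracking sequence is a cycle. -/
theorem IsNonbacktracking.exists_isCycle {U : Finset V} {m : ℕ} {f : ℕ → V}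
    (hf : IsNonbacktracking H U m f) (hm : U.card ≤ m) :
    ∃ i k, i + k ≤ m ∧ ∃ p : H.Walk (f i) (f i), p.IsCycle ∧
      p.support = (List.range (k + 1)).map fun l => f (i + l) := by
  classical
  have hex : ∃ k, 0 < k ∧ ∃ i, i + k ≤ m ∧ f (i + k) = f i := by
    obtain ⟨a, ha, b, hb, hne, hab⟩ := Finset.exists_ne_map_eq_of_card_lt_of_maps_to
      (s := Finset.Iic m) (t := U) (by simp; omega) fun l hl => hf.mem l (Finset.mem_Iic.1 hl)
    rw [Finset.mem_Iic] at ha hb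
    rcases Nat.lt_or_gt_of_ne hne with h | h
    · exact ⟨b - a, by omega, a, by omega, by rw [Nat.add_sub_cancel' h.le, hab]⟩
    · exact ⟨a - b, by omega, b, by omega, by rw [Nat.add_sub_cancel' h.le, hab]⟩
  have hmin (a b : ℕ) (hab : a < b) (hb : b ≤ m) (h : f a = f b) : Nat.find hex ≤ b - a :=
    Nat.find_min' hex ⟨by omega, a, by omega, by rw [Nat.add_sub_cancel' hab.le, h]⟩
  obtain ⟨hk, i, him, hik⟩ := Nat.find_spec hex
  set k := Nat.find hex
  have hk3 : 3 ≤ k := by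
    by_contra! hlt
    interval_cases k
    · exact (hf.adj i (by omega)).ne hik.symm
    · exact hf.ne i him hik
  refine ⟨i, k, him, exists_isCycle_of_injOn (g := fun l => f (i + l)) hk3
    (fun l hl => hf.adj (i + l) (by omega)) hik fun a ha b hb hab => ?_⟩
  have ha' := ha.2
  have hb' := hb.2
  by_contra hne
  rcases Nat.lt_or_gt_of_ne hne with h | h
  · have := hmin (i + a) (i + b) (by omega) (by omega) hab
    have := ha.1
    omega
  · have := hmin (i + b) (i + a) (by omega) (by omega) hab.symm
    have := hb.1
    omega

theorem HasMinDegTwo.exists_adj_ne {U : Finset V} (hU : HasMinDegTwo H U) (a : V) {b : V}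
    (hb : b ∈ U) : ∃ c ∈ U, H.Adj b c ∧ c ≠ a := by
  obtain ⟨y, hy, z, hz, hyz, hby, hbz⟩ := hU b hb
  by_cases hya : y = a
  · exact ⟨z, hz, hbz, fun hza => hyz (hya.trans hza.symm)⟩
  · exact ⟨y, hy, hby, hya⟩

theorem HasMinDegTwo.exists_isNonbacktracking {U : Finset V} (hU : HasMinDegTwo H U)
    (hne : U.Nonempty) (m : ℕ) : ∃ f, IsNonbacktracking H U m f := by
  induction m with
  | zero =>
    obtain ⟨x, hx⟩ := hne
    exact ⟨fun _ => x, fun _ _ => hx, by simp, by simp⟩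
  | succ m ih =>
    obtain ⟨f, hf⟩ := ih
    obtain ⟨x, hx, hadj, hxf⟩ := hU.exists_adj_ne (f (m - 1)) (hf.mem m le_rfl)
    exact ⟨_, hf.update hx hadj hxf⟩

theorem HasMinDegTwo.exists_isCycle [DecidableEq V] {U : Finset V} (hU : HasMinDegTwo H U)
    (hne : U.Nonempty) :
    ∃ (u : V) (p : H.Walk u u), p.IsCycle ∧ p.support.toFinset ⊆ U := by
  obtain ⟨f, hf⟩ := hU.exists_isNonbacktracking hne U.card
  obtain ⟨i, k, hik, p, hp, hsupp⟩ := hf.exists_isCycle le_rfl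
  refine ⟨_, p, hp, fun x hx => ?_⟩
  rw [List.mem_toFinset, hsupp, List.mem_map] at hx
  obtain ⟨l, hl, rfl⟩ := hx
  rw [List.mem_range] at hl
  exact hf.mem _ (by omega)

theorem isFeedbackVertexSet_of_forall_inter {X : Finset V}
    (h : ∀ U : Finset V, U.Nonempty → HasMinDegTwo H U → ∃ x ∈ U, x ∈ X) :
    IsFeedbackVertexSet H (X : Set V) := by
  classical
  intro u c hc
  have hU : HasMinDegTwo H (c.support.toFinset.image Subtype.val) := fun y hy => by
    obtain ⟨x, hx, rfl⟩ := Finset.mem_image.1 hy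
    obtain ⟨y, hy, z, hz, hyz, hxy, hxz⟩ := hasMinDegTwo_support hc x hx
    exact ⟨_, Finset.mem_image_of_mem _ hy, _, Finset.mem_image_of_mem _ hz,
      Subtype.coe_ne_coe.2 hyz, hxy, hxz⟩
  obtain ⟨y, hy, hyX⟩ := h _ ⟨u, Finset.mem_image_of_mem _ (by simp)⟩ hU
  obtain ⟨x, -, rfl⟩ := Finset.mem_image.1 hy
  exact x.2 hyX

end HasMinDegTwo

/-! ### Lightest sets of minimum degree two -/

section IsLightest

open SimpleGraph

variable {V : Type*} {H : SimpleGraph V} {w : V → ℕ}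

/-- The total weight of the vertices of a walk, with multiplicity and including both ends. -/
def walkWeight (w : V → ℕ) {a b : V} (p : H.Walk a b) : ℕ := (p.support.map w).sum

@[simp] theorem walkWeight_nil (a : V) : walkWeight w (.nil : H.Walk a a) = w a := by
  simp [walkWeight]

@[simp] theorem walkWeight_cons {a b c : V} (h : H.Adj a b) (p : H.Walk b c) :
    walkWeight w (.cons h p) = w a + walkWeight w p := by
  simp [walkWeight]

@[simp] theorem walkWeight_concat {a b c : V} (p : H.Walk a b) (h : H.Adj b c) :
    walkWeight w (p.concat h) = walkWeight w p + w c := by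
  simp [walkWeight, Walk.support_concat]

@[simp] theorem walkWeight_reverse {a b : V} (p : H.Walk a b) :
    walkWeight w p.reverse = walkWeight w p := by
  simp [walkWeight, List.sum_reverse]

theorem walkWeight_append_add {a b c : V} (p : H.Walk a b) (q : H.Walk b c) :
    walkWeight w (p.append q) + w b = walkWeight w p + walkWeight w q := by
  induction p with
  | nil => simp [add_comm]
  | cons h p ih => rw [Walk.cons_append, walkWeight_cons, walkWeight_cons, add_assoc, ih, add_assoc]

theorem walkWeight_congr {w' : V → ℕ} {a b : V} {p : H.Walk a b}
    (h : ∀ x ∈ p.support, w x = w' x) : walkWeight w p = walkWeight w' p :=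
  congrArg List.sum (List.map_congr_left h)

theorem le_walkWeight_of_mem {a b x : V} (p : H.Walk a b) (hx : x ∈ p.support) :
    w x ≤ walkWeight w p :=
  List.single_le_sum (fun _ _ => Nat.zero_le _) _ (List.mem_map_of_mem hx)

/-- A nonempty set of minimum degree at least two, of minimum weight among all these sets. -/
structure IsLightest (H : SimpleGraph V) (w : V → ℕ) (C : Finset V) : Prop where
  nonempty : C.Nonempty
  hasMinDegTwo : HasMinDegTwo H C
  sum_le : ∀ U : Finset V, U.Nonempty → HasMinDegTwo H U → ∑ x ∈ C, w x ≤ ∑ x ∈ U, w x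

theorem IsLightest.eq_of_subset {C U : Finset V} (hC : IsLightest H w C) (hw : ∀ x, 0 < w x)
    (hUC : U ⊆ C) (hne : U.Nonempty) (hU : HasMinDegTwo H U) : U = C := by
  by_contra h
  obtain ⟨x, hx, hxU⟩ := Finset.exists_of_ssubset (hUC.ssubset_of_ne h)
  exact (hC.sum_le U hne hU).not_gt
    (Finset.sum_lt_sum_of_subset hUC hx hxU (hw x) fun _ _ _ => Nat.zero_le _)

theorem eq_snd_or_eq_penultimate_of_mem_edges {y x : V} {c : H.Walk y y} (hc : c.IsCycle)
    (h : s(y, x) ∈ c.edges) : x = c.snd ∨ x = c.penultimate := by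
  have := hc.neighborSet_toSubgraph_endpoint
  have hx : x ∈ c.toSubgraph.neighborSet y := c.adj_toSubgraph_iff_mem_edges.2 h
  simpa [this] using hx

/-- The weights of the nonempty sets of minimum degree at least two. -/
def cycleWeights (H : SimpleGraph V) (w : V → ℕ) : Set ℕ :=
  {b | ∃ U : Finset V, U.Nonempty ∧ HasMinDegTwo H U ∧ ∑ x ∈ U, w x = b}

/-- The weights `w'` arise from `w` by raising some of them to `m`, and this neither changes the
minimum `M` of `m` and all cycle weights nor can be continued inside `S`: a vertex of `S` of weight
less than `m` lies in each set of weight at most `M`. Raising a weight to `m` deletes a vertex, as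
far as sets of weight less than `m` are concerned. -/
structure IsThinning (H : SimpleGraph V) (w : V → ℕ) (m M : ℕ) (S : Set V) (w' : V → ℕ) :
    Prop where
  eq_or_eq : ∀ x, w' x = w x ∨ w' x = m
  isLeast : IsLeast (insert m (cycleWeights H w')) M
  mem : ∀ x ∈ S, w' x < m → M < m ∧
    ∀ U : Finset V, U.Nonempty → HasMinDegTwo H U → ∑ x ∈ U, w' x ≤ M → x ∈ U

theorem IsThinning.isLightest [Fintype V] {w' : V → ℕ} {m M : ℕ}
    (hM : IsLeast (insert m (cycleWeights H w)) M) (h : IsThinning H w m M Set.univ w') :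
    (({x | w' x < m} : Finset V) = ∅ ∧ ∀ U : Finset V, U.Nonempty → HasMinDegTwo H U →
        m ≤ ∑ x ∈ U, w x) ∨
      IsLightest H w {x | w' x < m} ∧ ∑ x with w' x < m, w x < m := by
  have hmem := fun x => h.mem x (Set.mem_univ x)
  obtain rfl | hlt := (hM.2 (Set.mem_insert _ _)).eq_or_lt
  · exact Or.inl ⟨Finset.filter_eq_empty_iff.2 fun x _ hx => (hmem x hx).1.ne rfl,
      fun U hne hU => hM.2 (Or.inr ⟨U, hne, hU, rfl⟩)⟩
  obtain ⟨U, hne, hU, hUM⟩ := h.isLeast.1.resolve_left hlt.ne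
  have hC : ({x | w' x < m} : Finset V) = U := by
    ext x
    rw [Finset.mem_filter_univ]
    exact ⟨fun hx => (hmem x hx).2 U hne hU hUM.le, fun hx =>
      ((Finset.single_le_sum (fun _ _ => Nat.zero_le _) hx).trans_eq hUM).trans_lt hlt⟩
  have hsum : ∑ x ∈ U, w x = M := by
    rw [← hUM]
    refine Finset.sum_congr rfl fun x hx => ((h.eq_or_eq x).resolve_right ?_).symm
    rw [← hC, Finset.mem_filter_univ] at hx
    exact hx.ne
  rw [hC]
  exact Or.inr ⟨⟨hne, hU, fun U' hne' hU' => hsum.trans_le (hM.2 (Or.inr ⟨U', hne', hU', rfl⟩))⟩,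
    hsum.trans_lt hlt⟩

theorem exists_eq_cons_concat_of_isCycle {y : V} {c : H.Walk y y} (hc : c.IsCycle) :
    ∃ (x x' : V) (h : H.Adj y x) (h' : H.Adj x' y) (p : H.Walk x x'), c = .cons h (p.concat h') ∧
      x ≠ x' ∧ p.IsPath ∧ y ∉ p.support := by
  cases c with
  | nil => exact absurd rfl hc.ne_nil
  | @cons _ x _ h q =>
    have hsnd := hc.snd_ne_penultimate
    obtain ⟨hq, -⟩ := (Walk.cons_isCycle_iff _ _).1 hc
    cases q with
    | nil => exact absurd rfl h.ne
    | cons h₁ q =>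
      obtain ⟨x', p, h', heq⟩ := Walk.exists_cons_eq_concat h₁ q
      rw [heq] at hq hsnd ⊢
      rw [Walk.concat_isPath_iff] at hq
      refine ⟨x, x', h, h', p, rfl, ?_, hq.1, hq.2⟩
      rwa [Walk.snd_cons, Walk.penultimate_cons_of_not_nil _ _ (by simp [Walk.concat_eq_append]),
        Walk.penultimate_concat] at hsnd

theorem IsThinning.insert_of_lt [DecidableEq V] {w' : V → ℕ} {m M b : ℕ} {S : Set V}
    (h : IsThinning H w m M S w') {x : V}
    (hb : IsLeast (insert m (cycleWeights H (Function.update w' x m))) b) (hMb : M < b) :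
    IsThinning H w m M (insert x S) w' := by
  refine ⟨h.eq_or_eq, h.isLeast, ?_⟩
  rintro y (rfl | hy) hlt
  · refine ⟨hMb.trans_le (hb.2 (Set.mem_insert _ _)), fun U hne hU hUM => ?_⟩
    by_contra hyU
    refine (hUM.trans_lt hMb).not_ge (hb.2 (Or.inr ⟨U, hne, hU, ?_⟩))
    exact Finset.sum_update_of_notMem hyU _ _
  · exact h.mem y hy hlt

theorem IsThinning.update_of_le [DecidableEq V] {w' : V → ℕ} {m M b : ℕ} {S : Set V}
    (h : IsThinning H w m M S w') (hle : ∀ x, w' x ≤ m) {x : V}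
    (hb : IsLeast (insert m (cycleWeights H (Function.update w' x m))) b) (hbM : b ≤ M) :
    IsThinning H w m M (insert x S) (Function.update w' x m) := by
  have hmono (y : V) : w' y ≤ Function.update w' x m y := by
    rw [Function.update_apply]
    split_ifs with hyx
    exacts [hle y, le_rfl]
  have hMb : M ≤ b := by
    obtain rfl | ⟨U, hne, hU, rfl⟩ := hb.1
    · exact h.isLeast.2 (Set.mem_insert _ _)
    · exact (h.isLeast.2 (Or.inr ⟨U, hne, hU, rfl⟩)).trans (Finset.sum_le_sum fun y _ => hmono y)
  refine ⟨fun y => ?_, hbM.antisymm hMb ▸ hb, ?_⟩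
  · rw [Function.update_apply]
    split_ifs
    exacts [Or.inr rfl, h.eq_or_eq y]
  · rintro y (rfl | hy) hlt
    · simp at hlt
    · obtain ⟨hM, hU⟩ := h.mem y hy ((hmono y).trans_lt hlt)
      exact ⟨hM, fun U hne hdeg hle => hU U hne hdeg
        ((Finset.sum_le_sum fun y _ => hmono y).trans hle)⟩

theorem sum_toFinset_le [DecidableEq V] (l : List V) : ∑ x ∈ l.toFinset, w x ≤ (l.map w).sum := by
  induction l with
  | nil => simp
  | cons a l ih =>
    rw [List.toFinset_cons, List.map_cons, List.sum_cons]
    by_cases ha : a ∈ l.toFinset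
    · rw [Finset.insert_eq_of_mem ha]; omega
    · rw [Finset.sum_insert ha]; omega

theorem sum_le_walkWeight [DecidableEq V] {a b : V} {p : H.Walk a b} {U : Finset V}
    (hU : U ⊆ p.support.toFinset) : ∑ x ∈ U, w x ≤ walkWeight w p :=
  (Finset.sum_le_sum_of_subset hU).trans (sum_toFinset_le _)

theorem walkWeight_of_isPath [DecidableEq V] {a b : V} {p : H.Walk a b} (hp : p.IsPath) :
    walkWeight w p = ∑ x ∈ p.support.toFinset, w x :=
  (List.sum_toFinset w hp.support_nodup).symm

theorem walkWeight_bypass_le [DecidableEq V] {a b : V} (p : H.Walk a b) :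
    walkWeight w p.bypass ≤ walkWeight w p :=
  (walkWeight_of_isPath p.bypass_isPath).trans_le
    (sum_le_walkWeight fun _ hx => List.mem_toFinset.2
      (p.support_bypass_subset_support (List.mem_toFinset.1 hx)))

theorem walkWeight_of_isCycle [DecidableEq V] {u : V} {c : H.Walk u u} (hc : c.IsCycle) :
    walkWeight w c = ∑ x ∈ c.support.toFinset, w x + w u := by
  obtain ⟨x, x', h, h', p, rfl, -, hp, hu⟩ := exists_eq_cons_concat_of_isCycle hc
  have hsupp : (Walk.cons h (p.concat h')).support.toFinset = insert u p.support.toFinset := by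
    ext z; simp [Walk.support_concat]
  rw [hsupp, Finset.sum_insert (by simpa using hu), walkWeight_cons, walkWeight_concat,
    walkWeight_of_isPath hp, add_assoc]

theorem exists_hasMinDegTwo_of_return {x x' y : V} (hne : x ≠ x') (hx : H.Adj y x)
    (hx' : H.Adj y x') (p : H.Walk x x') (hy : y ∉ p.support) :
    ∃ U : Finset V, U.Nonempty ∧ HasMinDegTwo H U ∧ ∑ x ∈ U, w x ≤ w y + walkWeight w p := by
  classical
  obtain ⟨U, hUp, hU, hU2⟩ := exists_hasMinDegTwo_of_walk hx' (.cons hx p) (by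
    rw [Walk.edges_cons, List.mem_cons]
    rintro (h | h)
    · exact hne (by simpa [hx'.ne, hx.ne'] using h.symm)
    · exact hy (p.fst_mem_support_of_mem_edges h))
  exact ⟨U, hU, hU2, (sum_le_walkWeight hUp).trans_eq (walkWeight_cons hx p)⟩

/-- The weights of the closed walks through `y` that start and end with different edges, where each
further visit of `y` costs `m`. -/
def returnWeights [DecidableEq V] (H : SimpleGraph V) (w : V → ℕ) (m : ℕ) (y : V) : Set ℕ :=
  {b | ∃ x x', H.Adj y x ∧ H.Adj y x' ∧ x ≠ x' ∧
    ∃ p : H.Walk x x', w y + walkWeight (Function.update w y m) p = b}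

theorem walkWeight_update [DecidableEq V] {y a b : V} {m : ℕ} {p : H.Walk a b}
    (hy : y ∉ p.support) :
    walkWeight (Function.update w y m) p = walkWeight w p :=
  walkWeight_congr fun _ hx => Function.update_of_ne (ne_of_mem_of_not_mem hx hy) _ _

theorem isLeast_cycleWeights [DecidableEq V] {m b : ℕ}
    (hb : IsLeast (insert m (⋃ y, returnWeights H w m y)) b) :
    IsLeast (insert m (cycleWeights H w)) b := by
  have hlow : b ∈ lowerBounds (insert m (cycleWeights H w)) := by
    rintro _ (rfl | ⟨U, hne, hU, rfl⟩)
    · exact hb.2 (Set.mem_insert _ _)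
    · obtain ⟨y, c, hc, hcU⟩ := hU.exists_isCycle hne
      have hsum := walkWeight_of_isCycle (w := w) hc
      obtain ⟨x, x', h, h', p, rfl, hxx', -, hy⟩ := exists_eq_cons_concat_of_isCycle hc
      rw [walkWeight_cons, walkWeight_concat, ← add_assoc, Nat.add_right_cancel_iff] at hsum
      refine (hb.2 (Or.inr (Set.mem_iUnion.2 ⟨y, x, x', h, h'.symm, hxx', p, ?_⟩))).trans
        (Finset.sum_le_sum_of_subset hcU)
      rw [walkWeight_update hy, hsum]
  refine ⟨?_, hlow⟩
  obtain hbm | hbm := (hlow (Set.mem_insert _ _)).eq_or_lt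
  · exact Or.inl hbm
  obtain ⟨y, x, x', hx, hx', hne, p, rfl⟩ := Set.mem_iUnion.1 (hb.1.resolve_left hbm.ne)
  have hy : y ∉ p.support := fun hy => by
    have := le_walkWeight_of_mem (w := Function.update w y m) p hy
    rw [Function.update_self] at this
    omega
  rw [walkWeight_update hy] at hlow ⊢
  obtain ⟨U, hUne, hU, hle⟩ := exists_hasMinDegTwo_of_return (w := w) hne hx hx' p hy
  exact Or.inr ⟨U, hUne, hU, hle.antisymm (hlow (Or.inr ⟨U, hUne, hU, rfl⟩))⟩

variable {C : Finset V}

theorem IsLightest.le_walkWeight (hC : IsLightest H w C) {x y : V} (h : H.Adj x y)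
    (p : H.Walk x y) (hp : s(x, y) ∉ p.edges) : ∑ x ∈ C, w x ≤ walkWeight w p := by
  classical
  obtain ⟨U, hUp, hne, hU⟩ := exists_hasMinDegTwo_of_walk h p hp
  exact (hC.sum_le U hne hU).trans (sum_le_walkWeight hUp)

theorem IsLightest.exists_isCycle [DecidableEq V] (hC : IsLightest H w C)
    (hw : ∀ x, 0 < w x) {u : V} (hu : u ∈ C) :
    ∃ c : H.Walk u u, c.IsCycle ∧ c.support.toFinset = C := by
  obtain ⟨v, c, hc, hcC⟩ := hC.hasMinDegTwo.exists_isCycle hC.nonempty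
  have heq := hC.eq_of_subset hw hcC ⟨v, by simp⟩ (hasMinDegTwo_support hc)
  have hu' : u ∈ c.support := List.mem_toFinset.1 (heq ▸ hu)
  refine ⟨c.rotate u hu', hc.rotate hu', ?_⟩
  rw [← heq]
  ext x
  simp only [List.mem_toFinset, Walk.mem_support_rotate_iff]

theorem exists_arcs [DecidableEq V] {b : V} {c : H.Walk b b} (hc : c.IsCycle) {a : V}
    (ha : a ∈ c.support) :
    ∃ q r : H.Walk b a, q.edges ⊆ c.edges ∧ r.edges ⊆ c.edges ∧ q.support ⊆ c.support ∧
      r.support ⊆ c.support ∧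
      walkWeight w q + walkWeight w r = ∑ x ∈ c.support.toFinset, w x + w a + w b := by
  refine ⟨c.takeUntil a ha, (c.dropUntil a ha).reverse, c.edges_takeUntil_subset_edges ha, ?_,
    c.support_takeUntil_subset_support ha, ?_, ?_⟩
  · simpa using c.edges_dropUntil_subset_edges ha
  · simpa using c.support_dropUntil_subset_support ha
  · have hsplit := walkWeight_append_add (w := w) (c.takeUntil a ha) (c.dropUntil a ha)
    rw [Walk.take_spec, walkWeight_of_isCycle hc] at hsplit
    rw [walkWeight_reverse]
    omega

theorem IsLightest.le_of_ear (hC : IsLightest H w C) (hw : ∀ x, 0 < w x) {x x' y a b : V}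
    (hxx' : x ≠ x') (hx : H.Adj y x) (hx' : H.Adj y x') (hy : y ∉ C) (ha : a ∈ C) (hb : b ∈ C)
    (p : H.Walk x a) (p' : H.Walk x' b) (hp : y ∉ p.support) (hp' : y ∉ p'.support) :
    ∑ x ∈ C, w x ≤ 2 * (w y + walkWeight w p + walkWeight w p') := by
  classical
  obtain ⟨c, hc, rfl⟩ := hC.exists_isCycle hw hb
  obtain ⟨q, r, -, -, hq, hr, hqr⟩ := exists_arcs (w := w) hc (List.mem_toFinset.1 ha)
  have hclose (q : H.Walk b a) (hq : q.support ⊆ c.support) :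
      ∑ x ∈ c.support.toFinset, w x + w a + w b ≤
        w y + walkWeight w p + walkWeight w p' + walkWeight w q := by
    obtain ⟨U, hne, hU, hle⟩ := exists_hasMinDegTwo_of_return (w := w) hxx' hx hx'
      (p.append (q.reverse.append p'.reverse)) (by
        simp only [Walk.mem_support_append_iff, Walk.support_reverse, List.mem_reverse]
        rintro (h | h | h)
        exacts [hp h, hy (List.mem_toFinset.2 (hq h)), hp' h])
    have hsplit := walkWeight_append_add (w := w) p (q.reverse.append p'.reverse)
    have hsplit' := walkWeight_append_add (w := w) q.reverse p'.reverse
    simp only [walkWeight_reverse] at hsplit'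
    have := hC.sum_le U hne hU
    omega
  have := hclose q hq
  have := hclose r hr
  omega

theorem IsLightest.le_of_chord (hC : IsLightest H w C) (hw : ∀ x, 0 < w x) {y : V} (hy : y ∈ C)
    {Z : Finset V} (hZC : Z ⊆ C) (hZ : 2 < Z.card) (hyZ : ∀ z ∈ Z, H.Adj y z) {m : ℕ}
    (hm : ∀ x, w x ≤ m) : ∑ x ∈ C, w x ≤ 2 * m := by
  classical
  obtain ⟨c, hc, rfl⟩ := hC.exists_isCycle hw hy
  obtain ⟨x, hx, hxc⟩ := Finset.exists_mem_notMem_of_card_lt_card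
    ((Finset.card_le_two (a := c.snd) (b := c.penultimate)).trans_lt hZ)
  have hchord : s(y, x) ∉ c.edges := fun h => hxc (by
    simpa using eq_snd_or_eq_penultimate_of_mem_edges hc h)
  obtain ⟨q, r, hq, hr, -, -, hqr⟩ := exists_arcs (w := w) hc (List.mem_toFinset.1 (hZC hx))
  have := hC.le_walkWeight (hyZ x hx) q fun h => hchord (hq h)
  have := hC.le_walkWeight (hyZ x hx) r fun h => hchord (hr h)
  have := hm x
  have := hm y
  omega

end IsLightest

/-! ### Branch vertices of a lightest set -/

section Branch

open SimpleGraph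

variable {V : Type*} {H : SimpleGraph V} {C : Finset V} {w : V → ℕ} {m : ℕ}

/-- The vertex `x` has at least three neighbours. -/
def Branch (H : SimpleGraph V) (x : V) : Prop :=
  ∃ Z : Finset V, 2 < Z.card ∧ ∀ z ∈ Z, H.Adj x z

/-- The vertex `x` is joined to `C` by a walk with at most `m` branch vertices. -/
def Near (H : SimpleGraph V) (C : Finset V) (m : ℕ) (x : V) : Prop :=
  ∃ a ∈ C, ∃ p : H.Walk x a, ∃ B : Finset V, B.card ≤ m ∧ ∀ z ∈ p.support, Branch H z → z ∈ B

/-- The vertex `x` is joined to `C` by a walk of weight at most `r` that avoids `y`. -/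
def JoinedAvoiding (H : SimpleGraph V) (w : V → ℕ) (C : Finset V) (r : ℕ) (y x : V) : Prop :=
  ∃ a ∈ C, ∃ p : H.Walk x a, y ∉ p.support ∧ walkWeight w p ≤ r

/-- A vertex `y` outside `C` has two neighbours that are joined to `C` by walks of weight at most
`r` avoiding `y`. -/
def HasEar (H : SimpleGraph V) (w : V → ℕ) (C : Finset V) (r : ℕ) : Prop :=
  ∃ y ∉ C, ∃ x x', x ≠ x' ∧ H.Adj y x ∧ H.Adj y x' ∧
    JoinedAvoiding H w C r y x ∧ JoinedAvoiding H w C r y x'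

theorem near_of_walk {a x : V} (ha : a ∈ C) (p : H.Walk a x) : Near H C (p.length + 1) x := by
  classical
  refine ⟨a, ha, p.reverse, p.support.toFinset, ?_, fun z hz _ => by simpa using hz⟩
  simpa using List.toFinset_card_le p.support

theorem Near.mono {m' : ℕ} {x : V} (hx : Near H C m x) (h : m ≤ m') : Near H C m' x := by
  obtain ⟨a, ha, p, B, hB, hp⟩ := hx
  exact ⟨a, ha, p, B, hB.trans h, hp⟩

theorem Near.of_adj {x y : V} (hx : Near H C m x) (h : H.Adj y x) (hy : ¬ Branch H y) :
    Near H C m y := by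
  obtain ⟨a, ha, p, B, hB, hp⟩ := hx
  refine ⟨a, ha, .cons h p, B, hB, fun z hz hz' => ?_⟩
  obtain rfl | hz := List.mem_cons.1 hz
  exacts [absurd hz' hy, hp z hz hz']

theorem walkWeight_dropUntil_add_le [DecidableEq V] {a b x : V} (p : H.Walk a b)
    (hx : x ∈ p.support) (ha : x ≠ a) : walkWeight w (p.dropUntil x hx) + w a ≤ walkWeight w p := by
  have hsplit := walkWeight_append_add (w := w) (p.takeUntil x hx) (p.dropUntil x hx)
  rw [p.take_spec hx] at hsplit
  obtain ⟨b, h, q, hq⟩ := Walk.not_nil_iff.1 (Walk.not_nil_of_ne (p := p.takeUntil x hx) ha.symm)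
  rw [hq, walkWeight_cons] at hsplit
  have := le_walkWeight_of_mem (w := w) q q.end_mem_support
  omega

theorem exists_branch_of_walk (hC : HasMinDegTwo H C) {c u : V} (hc : c ∈ C) (hu : u ∉ C)
    (p : H.Walk c u) : ∃ b ∈ C, Branch H b ∧ ∃ q : H.Walk b u, q.length ≤ p.length := by
  classical
  induction p with
  | nil => exact absurd hc hu
  | @cons c c' u h p ih =>
    by_cases hc' : c' ∈ C
    · obtain ⟨b, hb, hbr, q, hq⟩ := ih hc' hu
      exact ⟨b, hb, hbr, q, hq.trans (Nat.le_succ _)⟩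
    · obtain ⟨y, hy, z, hz, hyz, hcy, hcz⟩ := hC c hc
      refine ⟨c, hc, ⟨{y, z, c'}, ?_, by simp [hcy, hcz, h]⟩, .cons h p, le_rfl⟩
      rw [Finset.card_eq_three.2 ⟨y, z, c', hyz, ne_of_mem_of_not_mem hy hc',
        ne_of_mem_of_not_mem hz hc', rfl⟩]
      exact Nat.lt_succ_self 2

theorem HasMinDegTwo.inter [DecidableEq V] {U : Finset V} (hU : HasMinDegTwo H U)
    (hC : HasMinDegTwo H C) (hbr : ∀ b ∈ U ∩ C, ¬ Branch H b) : HasMinDegTwo H (U ∩ C) := by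
  intro x hx
  obtain ⟨hxU, hxC⟩ := Finset.mem_inter.1 hx
  have hmem {v : V} (hv : H.Adj x v) : v ∈ C := by
    by_contra hvC
    obtain ⟨y, hy, z, hz, hyz, hxy, hxz⟩ := hC x hxC
    refine hbr x hx ⟨{y, z, v}, ?_, by simp [hxy, hxz, hv]⟩
    rw [Finset.card_eq_three.2 ⟨y, z, v, hyz, ne_of_mem_of_not_mem hy hvC,
      ne_of_mem_of_not_mem hz hvC, rfl⟩]
    exact Nat.lt_succ_self 2
  obtain ⟨y, hy, z, hz, hyz, hxy, hxz⟩ := hU x hxU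
  exact ⟨y, Finset.mem_inter.2 ⟨hy, hmem hxy⟩, z, Finset.mem_inter.2 ⟨hz, hmem hxz⟩, hyz, hxy, hxz⟩

variable [Fintype V]

theorem Near.exists_walk {x : V} (hx : Near H C m x) (hw : ∀ x, w x ≤ Fintype.card V)
    (hn : ∀ x, ¬ Branch H x → w x ≤ 1) :
    ∃ a ∈ C, ∃ p : H.Walk x a, walkWeight w p ≤ Fintype.card V * (m + 1) ∧
      ∀ y ∈ p.support, Near H C m y := by
  classical
  obtain ⟨a, ha, p, B, hB, hp⟩ := hx
  replace hp : ∀ z ∈ p.bypass.support, Branch H z → z ∈ B := fun z hz =>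
    hp z (p.support_bypass_subset_support hz)
  refine ⟨a, ha, p.bypass, ?_, fun y hy => ⟨a, ha, p.bypass.dropUntil y hy, B, hB, fun z hz =>
    hp z (p.bypass.support_dropUntil_subset_support hy hz)⟩⟩
  calc walkWeight w p.bypass
      ≤ ∑ x ∈ p.bypass.support.toFinset, ((if x ∈ B then Fintype.card V else 0) + 1) := by
        rw [walkWeight_of_isPath p.bypass_isPath]
        refine Finset.sum_le_sum fun x hx => ?_
        split_ifs with hxB
        · exact (hw x).trans (Nat.le_succ _)
        · exact hn x fun hbr => hxB (hp x (List.mem_toFinset.1 hx) hbr)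
    _ ≤ ∑ x, ((if x ∈ B then Fintype.card V else 0) + 1) :=
        Finset.sum_le_sum_of_subset (Finset.subset_univ _)
    _ = Fintype.card V * (B.card + 1) := by
        rw [Finset.sum_add_distrib, Finset.sum_ite_mem]
        simp only [Finset.univ_inter, Finset.sum_const, Finset.card_univ, smul_eq_mul]
        ring
    _ ≤ Fintype.card V * (m + 1) := Nat.mul_le_mul_left _ (Nat.add_le_add_right hB 1)

omit [Fintype V] in
/-- The vertices that are not near `C` do not form a set of minimum degree two. One of them with at
most one neighbour of this kind is a branch vertex, since it would be near `C` otherwise. -/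
theorem exists_branch_not_near [Finite V] (hdeg : ∀ x y, H.Adj x y → ∃ z ≠ y, H.Adj x z)
    (hB : ∀ U : Finset V, U.Nonempty → HasMinDegTwo H U → ∃ u ∈ U, Near H C m u) {y z : V}
    (hy : ¬ Near H C m y) (hyz : H.Adj y z) :
    ∃ y, ¬ Near H C m y ∧ Branch H y ∧
      ∀ a b, a ≠ b → H.Adj y a → H.Adj y b → Near H C m a ∨ Near H C m b := by
  classical
  have := Fintype.ofFinite V
  have hY : ¬ HasMinDegTwo H {y : V | ¬ Near H C m y ∧ ∃ z, H.Adj y z} := fun h => by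
    obtain ⟨u, hu, hnear⟩ := hB _ ⟨y, by simpa using ⟨hy, z, hyz⟩⟩ h
    exact (Finset.mem_filter.1 hu).2.1 hnear
  simp only [HasMinDegTwo, not_forall, Finset.mem_filter_univ] at hY
  obtain ⟨y, ⟨hy, z, hyz⟩, hno⟩ := hY
  have hfew (a b : V) (hab : a ≠ b) (ha : H.Adj y a) (hb : H.Adj y b) :
      Near H C m a ∨ Near H C m b := by
    by_contra! hcon
    exact hno ⟨a, ⟨hcon.1, y, ha.symm⟩, b, ⟨hcon.2, y, hb.symm⟩, hab, ha, hb⟩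
  refine ⟨y, hy, ?_, hfew⟩
  by_contra hbr
  obtain ⟨z', hne, hz'⟩ := hdeg y z hyz
  obtain h | h := hfew z' z hne hz' hyz
  exacts [hy (h.of_adj hz' hbr), hy (h.of_adj hyz hbr)]

theorem hasEar_of_not_near (hw : ∀ x, w x ≤ Fintype.card V) (hn : ∀ x, ¬ Branch H x → w x ≤ 1)
    (hC : ∀ x ∈ C, Near H C m x) {y : V} (hy : ¬ Near H C m y) (hbr : Branch H y)
    (hfew : ∀ a b, a ≠ b → H.Adj y a → H.Adj y b → Near H C m a ∨ Near H C m b) :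
    HasEar H w C (Fintype.card V * (m + 1)) := by
  have hjoin {x : V} (hx : Near H C m x) : JoinedAvoiding H w C (Fintype.card V * (m + 1)) y x := by
    obtain ⟨a, ha, p, hp, hnear⟩ := hx.exists_walk hw hn
    exact ⟨a, ha, p, fun h => hy (hnear y h), hp⟩
  refine ⟨y, fun h => hy (hC y h), ?_⟩
  obtain ⟨Z, hZ, hyZ⟩ := hbr
  obtain ⟨a, ha, b, hb, c, hc, hab, hac, hbc⟩ := Finset.two_lt_card.1 hZ
  by_cases hna : Near H C m a
  · obtain h | h := hfew b c hbc (hyZ b hb) (hyZ c hc)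
    exacts [⟨a, b, hab, hyZ a ha, hyZ b hb, hjoin hna, hjoin h⟩,
      ⟨a, c, hac, hyZ a ha, hyZ c hc, hjoin hna, hjoin h⟩]
  · exact ⟨b, c, hbc, hyZ b hb, hyZ c hc,
      hjoin ((hfew a b hab (hyZ a ha) (hyZ b hb)).resolve_left hna),
      hjoin ((hfew a c hac (hyZ a ha) (hyZ c hc)).resolve_left hna)⟩

/-- A vertex farthest from `C` is avoided by the lightest walks from its neighbours to `C`. -/
theorem hasEar_of_forall_near (hw : ∀ x, w x ≤ Fintype.card V) (hpos : ∀ x, 0 < w x)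
    (hn : ∀ x, ¬ Branch H x → w x ≤ 1) (hdeg : ∀ x y, H.Adj x y → ∃ z ≠ y, H.Adj x z)
    (hnear : ∀ x y, H.Adj x y → Near H C m x) {y z : V} (hy : y ∉ C) (hyz : H.Adj y z) :
    HasEar H w C (Fintype.card V * (m + 1)) := by
  classical
  let W (x : V) : Set ℕ := {b | ∃ a ∈ C, ∃ p : H.Walk x a, walkWeight w p = b}
  let E (x : V) : ℕ := sInf (W x)
  have hE {x a : V} (ha : a ∈ C) (p : H.Walk x a) : E x ≤ walkWeight w p :=
    Nat.sInf_le ⟨a, ha, p, rfl⟩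
  obtain ⟨y, hmem, hmax⟩ := Finset.exists_max_image {y | y ∉ C ∧ ∃ z, H.Adj y z} E
    ⟨y, by simpa using ⟨hy, z, hyz⟩⟩
  clear hy hyz z
  simp only [Finset.mem_filter_univ] at hmem hmax
  obtain ⟨hy, x, hx⟩ := hmem
  have hjoin {x : V} (hx : H.Adj x y) : JoinedAvoiding H w C (Fintype.card V * (m + 1)) y x := by
    by_cases hxC : x ∈ C
    · exact ⟨x, hxC, .nil, by simpa using hx.ne',
        by simpa using (hw x).trans (Nat.le_mul_of_pos_right _ m.succ_pos)⟩
    obtain ⟨b, hb, q, hq, -⟩ := (hnear x y hx).exists_walk hw hn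
    obtain ⟨a, ha, p, hp⟩ : ∃ a ∈ C, ∃ p : H.Walk x a, walkWeight w p = E x :=
      Nat.sInf_mem (s := W x) ⟨_, b, hb, q, rfl⟩
    refine ⟨a, ha, p, fun hyp => ?_, hp.trans_le ((hE hb q).trans hq)⟩
    have := walkWeight_dropUntil_add_le (w := w) p hyp hx.ne'
    have := hE ha (p.dropUntil y hyp)
    have := hmax x ⟨hxC, y, hx⟩
    have := hpos x
    omega
  obtain ⟨x', hne, hx'⟩ := hdeg y x hx
  exact ⟨y, hy, x', x, hne, hx', hx, hjoin hx'.symm, hjoin hx.symm⟩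

open scoped Classical in
/-- The vertices at distance at most `d` from `S`. -/
noncomputable def ball (H : SimpleGraph V) (d : ℕ) (S : Finset V) : Finset V :=
  {x | ∃ a ∈ S, ∃ p : H.Walk a x, p.length ≤ d}

@[simp] theorem mem_ball {d : ℕ} {S : Finset V} {x : V} :
    x ∈ ball H d S ↔ ∃ a ∈ S, ∃ p : H.Walk a x, p.length ≤ d := by
  simp [ball]

variable {d : ℕ}

theorem hasEar_of_forall_mem_ball (hw : ∀ x, w x ≤ Fintype.card V)
    (hpos : ∀ x, 0 < w x) (hn : ∀ x, ¬ Branch H x → w x ≤ 1)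
    (hdeg : ∀ x y, H.Adj x y → ∃ z ≠ y, H.Adj x z)
    (hB : ∀ U : Finset V, U.Nonempty → HasMinDegTwo H U → ∃ u ∈ U, u ∈ ball H d C) {y z : V}
    (hy : y ∉ C) (hyz : H.Adj y z) : HasEar H w C (Fintype.card V * (d + 2)) := by
  by_cases hnear : ∀ x y, H.Adj x y → Near H C (d + 1) x
  · exact hasEar_of_forall_near hw hpos hn hdeg hnear hy hyz
  push Not at hnear
  obtain ⟨y, z, hyz, hy⟩ := hnear
  have hmeet (U : Finset V) (hne : U.Nonempty) (hU : HasMinDegTwo H U) :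
      ∃ u ∈ U, Near H C (d + 1) u := by
    obtain ⟨u, hu, hball⟩ := hB U hne hU
    obtain ⟨c, hc, p, hp⟩ := mem_ball.1 hball
    exact ⟨u, hu, (near_of_walk hc p).mono (Nat.add_le_add_right hp 1)⟩
  obtain ⟨y, hy, hbr, hfew⟩ := exists_branch_not_near hdeg hmeet hy hyz
  exact hasEar_of_not_near hw hn (fun x hx => (near_of_walk hx .nil).mono (Nat.le_add_left 1 d))
    hy hbr hfew

theorem IsLightest.card_branch_le [DecidablePred (Branch H)]
    (hC : IsLightest H w C) (hw : ∀ x, w x = if Branch H x then Fintype.card V else 1)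
    (hdeg : ∀ x y, H.Adj x y → ∃ z ≠ y, H.Adj x z)
    (hB : ∀ U : Finset V, U.Nonempty → HasMinDegTwo H U → ∃ u ∈ U, u ∈ ball H d C) :
    (C.filter (Branch H)).card ≤ 4 * d + 12 := by
  have hcard : 0 < Fintype.card V := Fintype.card_pos_iff.2 ⟨hC.nonempty.choose⟩
  have hle (x : V) : w x ≤ Fintype.card V := by rw [hw]; split_ifs <;> omega
  have hpos (x : V) : 0 < w x := by rw [hw]; split_ifs <;> omega
  suffices hsum : ∑ x ∈ C, w x ≤ (4 * d + 12) * Fintype.card V by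
    refine Nat.le_of_mul_le_mul_right (le_trans ?_ hsum) hcard
    rw [← smul_eq_mul]
    refine (Finset.card_nsmul_le_sum _ w _ fun x hx => ?_).trans
      (Finset.sum_le_sum_of_subset (Finset.filter_subset (Branch H) C))
    rw [hw, if_pos (Finset.mem_filter.1 hx).2]
  by_cases hex : ∃ y z, y ∉ C ∧ H.Adj y z
  · obtain ⟨y, z, hy, hyz⟩ := hex
    obtain ⟨y, hy, x, x', hne, hx, hx', ⟨a, ha, p, hp, hpw⟩, b, hb, q, hq, hqw⟩ :=
      hasEar_of_forall_mem_ball hle hpos (fun x hx => by rw [hw, if_neg hx]) hdeg hB hy hyz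
    have := hC.le_of_ear hpos hne hx hx' hy ha hb p q hp hq
    have := hle y
    nlinarith
  have hCadj (y z : V) (h : H.Adj y z) : y ∈ C := by_contra fun hy => hex ⟨y, z, hy, h⟩
  by_cases hbr : ∃ y ∈ C, Branch H y
  · obtain ⟨y, hy, Z, hZ, hyZ⟩ := hbr
    have := hC.le_of_chord hpos hy (fun z hz => hCadj z y (hyZ z hz).symm) hZ hyZ hle
    nlinarith
  · have : ∑ x ∈ C, w x ≤ C.card * 1 :=
      Finset.sum_le_card_nsmul _ _ 1 fun x hx => by rw [hw, if_neg fun h => hbr ⟨x, hx, h⟩]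
    have := Finset.card_le_univ C
    nlinarith

theorem IsLightest.exists_mem_ball [DecidableEq V] [DecidablePred (Branch H)]
    (hC : IsLightest H w C) (hw : ∀ x, 0 < w x)
    (hB : ∀ U : Finset V, U.Nonempty → HasMinDegTwo H U → ∃ u ∈ U, u ∈ ball H d C) {c₀ : V}
    (hc₀ : c₀ ∈ C) {U : Finset V} (hne : U.Nonempty) (hU : HasMinDegTwo H U) :
    ∃ u ∈ U, u ∈ ball H d {x ∈ C | Branch H x ∨ x = c₀} := by
  simp only [mem_ball, Finset.mem_filter]
  obtain ⟨u, hu, hball⟩ := hB U hne hU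
  obtain ⟨c, hc, p, hp⟩ := mem_ball.1 hball
  by_cases huC : u ∈ C
  · by_cases hbr : ∃ b ∈ U ∩ C, Branch H b
    · obtain ⟨b, hb, hbr⟩ := hbr
      rw [Finset.mem_inter] at hb
      exact ⟨b, hb.1, b, ⟨hb.2, Or.inl hbr⟩, .nil, d.zero_le⟩
    · push Not at hbr
      have heq := hC.eq_of_subset hw Finset.inter_subset_right ⟨u, Finset.mem_inter.2 ⟨hu, huC⟩⟩
        (hU.inter hC.hasMinDegTwo hbr)
      exact ⟨c₀, Finset.inter_eq_right.1 heq hc₀, c₀, ⟨hc₀, Or.inr rfl⟩, .nil, d.zero_le⟩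
  · obtain ⟨b, hb, hbr, q, hq⟩ := exists_branch_of_walk hC.hasMinDegTwo hc huC p
    exact ⟨u, hu, b, ⟨hb, Or.inl hbr⟩, q, hq.trans hp⟩

theorem card_ball_le [DecidableRel H.Adj] {t : ℕ} (ht : H.maxDegree ≤ t) (S : Finset V) (d : ℕ) :
    (ball H d S).card ≤ S.card * ∑ i ∈ Finset.range (d + 1), t ^ i := by
  classical
  let N (i : ℕ) : Finset V := (fun T => T.biUnion fun x => H.neighborFinset x)^[i] S
  have hN (i : ℕ) : N (i + 1) = (N i).biUnion fun x => H.neighborFinset x :=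
    Function.iterate_succ_apply' ..
  have hcard (i : ℕ) : (N i).card ≤ S.card * t ^ i := by
    induction i with
    | zero => simp [N]
    | succ i ih =>
      rw [hN, pow_succ, ← mul_assoc]
      exact (Finset.card_biUnion_le_card_mul _ _ _ fun x _ =>
        (H.degree_le_maxDegree x).trans ht).trans (Nat.mul_le_mul_right _ ih)
  have hmem {a x : V} (p : H.Walk a x) : ∀ i, a ∈ N i → x ∈ N (i + p.length) := by
    induction p with
    | nil => exact fun i ha => ha
    | cons h p ih =>
      intro i ha
      have := ih (i + 1) (by rw [hN]; exact Finset.mem_biUnion.2 ⟨_, ha, by simpa using h⟩)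
      rwa [Walk.length_cons, add_comm p.length, ← add_assoc]
  have hsub : ball H d S ⊆ (Finset.range (d + 1)).biUnion N := fun x hx => by
    obtain ⟨a, ha, p, hp⟩ := mem_ball.1 hx
    exact Finset.mem_biUnion.2
      ⟨p.length, Finset.mem_range_succ_iff.2 hp, by simpa using hmem p 0 ha⟩
  calc (ball H d S).card ≤ ∑ i ∈ Finset.range (d + 1), (N i).card :=
        (Finset.card_le_card hsub).trans Finset.card_biUnion_le
    _ ≤ ∑ i ∈ Finset.range (d + 1), S.card * t ^ i := Finset.sum_le_sum fun i _ => hcard i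
    _ = S.card * ∑ i ∈ Finset.range (d + 1), t ^ i := (Finset.mul_sum ..).symm

end Branch

/-! ### Passing to the core -/

section Core

open SimpleGraph

variable {V : Type*} {G : SimpleGraph V} {K C : Finset V} {w : V → ℕ}

theorem HasMinDegTwo.to_restrict (hK : IsGreatest {U : Finset V | HasMinDegTwo G U} K)
    {U : Finset V} (hU : HasMinDegTwo G U) : HasMinDegTwo (restrict G K) U :=
  hU.mono fun _ hx _ hy h => restrict_adj.2 ⟨h, hK.2 hU hx, hK.2 hU hy⟩

theorem IsLightest.to_restrict (hK : IsGreatest {U : Finset V | HasMinDegTwo G U} K)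
    (hC : IsLightest G w C) : IsLightest (restrict G K) w C :=
  ⟨hC.nonempty, hC.hasMinDegTwo.to_restrict hK, fun U hne hU => hC.sum_le U hne hU.of_restrict⟩

theorem HasMinDegTwo.exists_restrict_adj (hK : HasMinDegTwo G K) {x y : V}
    (h : (restrict G K).Adj x y) : ∃ z ≠ y, (restrict G K).Adj x z := by
  have hx := (restrict_adj.1 h).2.1
  obtain ⟨z, hz, hxz, hzy⟩ := hK.exists_adj_ne y hx
  exact ⟨z, hzy, restrict_adj.2 ⟨hxz, hx, hz⟩⟩

theorem HasMinDegTwo.union_support [DecidableEq V] (hK : HasMinDegTwo G K) {u v : V} (hu : u ∈ K)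
    (hv : v ∈ K) {p : G.Walk u v} (hp : p.IsPath) : HasMinDegTwo G (K ∪ p.support.toFinset) := by
  intro x hx
  by_cases hxK : x ∈ K
  · obtain ⟨a, ha, b, hb, h⟩ := hK x hxK
    exact ⟨a, Finset.mem_union_left _ ha, b, Finset.mem_union_left _ hb, h⟩
  have hmem (i : ℕ) : p.getVert i ∈ K ∪ p.support.toFinset :=
    Finset.mem_union_right _ (List.mem_toFinset.2 (p.getVert_mem_support i))
  obtain ⟨i, rfl, hi⟩ := Walk.mem_support_iff_exists_getVert.1
    (List.mem_toFinset.1 ((Finset.mem_union.1 hx).resolve_left hxK))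
  have hi' : i ≠ p.length := by rintro rfl; exact hxK (p.getVert_length.symm ▸ hv)
  obtain - | j := i
  · exact absurd (p.getVert_zero.symm ▸ hu) hxK
  refine ⟨_, hmem j, _, hmem (j + 2), fun h => ?_, (p.adj_getVert_succ (by omega)).symm,
    p.adj_getVert_succ (by omega)⟩
  have := hp.getVert_injOn (show j ≤ p.length by omega) (show j + 2 ≤ p.length by omega) h
  omega

theorem exists_walk_restrict (hK : IsGreatest {U : Finset V | HasMinDegTwo G U} K) {u v : V}
    (hu : u ∈ K) (hv : v ∈ K) (p : G.Walk u v) :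
    ∃ q : (restrict G K).Walk u v, q.length ≤ p.length := by
  classical
  have hsub : ∀ x ∈ p.bypass.support, x ∈ K := fun x hx =>
    hK.2 (hK.1.union_support hu hv p.bypass_isPath)
      (Finset.mem_union_right _ (List.mem_toFinset.2 hx))
  refine ⟨p.bypass.transfer _ fun e he => ?_, ?_⟩
  · induction e with | h a b => ?_
    exact restrict_adj.2 ⟨p.bypass.adj_of_mem_edges he,
      hsub _ (Walk.fst_mem_support_of_mem_edges _ he),
      hsub _ (Walk.snd_mem_support_of_mem_edges _ he)⟩
  · rw [Walk.length_transfer]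
    exact p.length_bypass_le_length

variable [Fintype V] {d t : ℕ}

theorem ball_mono_graph {H : SimpleGraph V} (h : H ≤ G) (S : Finset V) :
    ball H d S ⊆ ball G d S := fun x hx => by
  obtain ⟨a, ha, p, hp⟩ := mem_ball.1 hx
  exact mem_ball.2 ⟨a, ha, p.mapLe h, by simpa using hp⟩

theorem exists_mem_ball_restrict (hK : IsGreatest {U : Finset V | HasMinDegTwo G U} K) (hC : C ⊆ K)
    (hB : ∀ U : Finset V, U.Nonempty → HasMinDegTwo G U → ∃ u ∈ U, u ∈ ball G d C) (U : Finset V)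
    (hne : U.Nonempty) (hU : HasMinDegTwo (restrict G K) U) :
    ∃ u ∈ U, u ∈ ball (restrict G K) d C := by
  obtain ⟨u, hu, hball⟩ := hB U hne hU.of_restrict
  obtain ⟨c, hc, p, hp⟩ := mem_ball.1 hball
  obtain ⟨q, hq⟩ := exists_walk_restrict hK (hC hc) (hU.mem_of_restrict hu) p
  exact ⟨u, hu, mem_ball.2 ⟨c, hc, q, hq.trans hp⟩⟩

variable [DecidableEq V] [DecidablePred (Branch (restrict G K))]

theorem isFeedbackVertexSet_ball (hK : IsGreatest {U : Finset V | HasMinDegTwo G U} K)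
    (hC : IsLightest G w C) (hw : ∀ x, 0 < w x)
    (hB : ∀ U : Finset V, U.Nonempty → HasMinDegTwo G U → ∃ u ∈ U, u ∈ ball G d C) {c₀ : V}
    (hc₀ : c₀ ∈ C) :
    IsFeedbackVertexSet G (ball G d {x ∈ C | Branch (restrict G K) x ∨ x = c₀} : Set V) := by
  refine isFeedbackVertexSet_of_forall_inter fun U hne hU => ?_
  obtain ⟨u, hu, hball⟩ := (hC.to_restrict hK).exists_mem_ball hw
    (exists_mem_ball_restrict hK (hK.2 hC.hasMinDegTwo) hB) hc₀ hne (hU.to_restrict hK)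
  exact ⟨u, hu, ball_mono_graph (fun _ _ h => (restrict_adj.1 h).1) _ hball⟩

theorem card_ball_le_of_isLightest [DecidableRel G.Adj]
    (hK : IsGreatest {U : Finset V | HasMinDegTwo G U} K) (hC : IsLightest G w C)
    (hw : ∀ x, w x = if Branch (restrict G K) x then Fintype.card V else 1)
    (hB : ∀ U : Finset V, U.Nonempty → HasMinDegTwo G U → ∃ u ∈ U, u ∈ ball G d C) (c₀ : V)
    (hd : 0 < d) (ht : G.maxDegree ≤ t) :
    (ball G d {x ∈ C | Branch (restrict G K) x ∨ x = c₀}).card ≤ 17 * (d * t ^ (2 * d)) := by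
  have hCK := hK.2 hC.hasMinDegTwo
  have ht2 : 2 ≤ t := by
    obtain ⟨x, hx⟩ := hC.nonempty
    obtain ⟨y, -, z, -, hyz, hy, hz⟩ := hC.hasMinDegTwo x hx
    exact (Finset.one_lt_card.2 ⟨y, by simpa using hy, z, by simpa using hz, hyz⟩).trans_le
      ((G.degree_le_maxDegree x).trans ht)
  have hcard : ({x ∈ C | Branch (restrict G K) x ∨ x = c₀} : Finset V).card ≤ 4 * d + 13 := by
    have := (hC.to_restrict hK).card_branch_le hw (fun _ _ => hK.1.exists_restrict_adj)
      (exists_mem_ball_restrict hK hCK hB)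
    rw [Finset.filter_or]
    have := Finset.card_union_le (C.filter (Branch (restrict G K))) {x ∈ C | x = c₀}
    have : ({x ∈ C | x = c₀} : Finset V).card ≤ 1 := Finset.card_le_one.2 (by simp +contextual)
    omega
  calc _ ≤ _ := card_ball_le ht _ d
    _ ≤ (17 * d) * t ^ (2 * d) := Nat.mul_le_mul (by omega)
        ((Nat.geomSum_lt ht2 fun _ => Finset.mem_range.1).le.trans
          (Nat.pow_le_pow_right (by omega) (by omega)))
    _ = _ := mul_assoc ..

end Core

/-! ### Packings -/

section Packing

open SimpleGraph

variable {n d : ℕ} {G : SimpleGraph (Fin n)} {s : Memory} {C D : Finset (Fin n)}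

/-- Array `a` of the memory `s` lists a cycle with vertex set `C`. -/
def ListsCycle (G : SimpleGraph (Fin n)) (s : Memory) (a : ℕ) (C : Finset (Fin n)) : Prop :=
  ∃ (u : Fin n) (p : G.Walk u u), p.IsCycle ∧ p.support.toFinset = C ∧
    p.support.map (fun v : Fin n => (v : ℕ)) = s.list a

theorem outputsPacking_of_listsCycle (h0 : s.reg 0 = 1) (hC : ListsCycle G s 1 C)
    (hD : ListsCycle G s 2 D) (hfar : ∀ x ∈ D, x ∉ ball G d C) : OutputsPacking G d s := by
  obtain ⟨u, p, hp, rfl, hps⟩ := hC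
  obtain ⟨v, q, hq, rfl, hqs⟩ := hD
  have hlong {x y : Fin n} (hx : x ∈ p.toSubgraph.verts) (hy : y ∈ q.toSubgraph.verts)
      (r : G.Walk x y) : ¬ r.length ≤ d := fun hr => by
    rw [Walk.mem_verts_toSubgraph] at hx hy
    exact hfar y (List.mem_toFinset.2 hy) (mem_ball.2 ⟨x, List.mem_toFinset.2 hx, r, hr⟩)
  refine ⟨h0, p.toSubgraph, q.toSubgraph, fun he => ?_, ⟨?_, ?_⟩,
    ⟨u, p, hp, rfl, (map_coe_list _).trans hps⟩, ⟨v, q, hq, rfl, (map_coe_list _).trans hqs⟩⟩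
  · exact hlong (x := u) (by simp) (he ▸ by simp) .nil d.zero_le
  · rintro _ (rfl | rfl)
    exacts [⟨u, p, hp, rfl⟩, ⟨v, q, hq, rfl⟩]
  · rintro _ (rfl | rfl) _ (rfl | rfl) hne x hx y hy r -
    · exact absurd rfl hne
    · exact hlong hx hy r
    · rw [← Walk.length_reverse]
      exact hlong hy hx r.reverse
    · exact absurd rfl hne

end Packing

/-! ### Walks of least weight -/

theorem walkWeight_one {V : Type*} {H : SimpleGraph V} {a b : V} (p : H.Walk a b) :
    walkWeight (fun _ => 1) p = p.length + 1 := by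
  simp [walkWeight]

theorem IsLightest.exists_isCycle_of_isNonbacktracking {V : Type*} [DecidableEq V]
    {H : SimpleGraph V} {w : V → ℕ} {C : Finset V} {f : ℕ → V} (hC : IsLightest H w C)
    (hw : ∀ x, 0 < w x) (hf : IsNonbacktracking H C C.card f) :
    ∃ (u : V) (p : H.Walk u u), p.IsCycle ∧ p.support.toFinset = C ∧
      p.support = (List.range (C.card + 1)).map f := by
  obtain ⟨i, k, hik, p, hp, hsupp⟩ := hf.exists_isCycle le_rfl
  have hpC : p.support.toFinset = C := by
    refine hC.eq_of_subset hw (fun x hx => ?_) ⟨f i, by simp⟩ (hasMinDegTwo_support hp)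
    rw [List.mem_toFinset, hsupp, List.mem_map] at hx
    obtain ⟨l, hl, rfl⟩ := hx
    rw [List.mem_range] at hl
    exact hf.mem _ (by omega)
  have hcard : p.length = C.card := by
    have := walkWeight_of_isCycle (w := fun _ => 1) hp
    rwa [walkWeight_one, Nat.add_right_cancel_iff, hpC, Finset.sum_const, smul_eq_mul, mul_one]
      at this
  have hlen : p.length = k := by simpa using congrArg List.length hsupp
  obtain rfl : i = 0 := by omega
  refine ⟨_, p, hp, hpC, ?_⟩
  simpa [← hcard, hlen] using hsupp

section Estimate

open SimpleGraph

variable {V : Type*} {H : SimpleGraph V} {w D D' : V → ℕ} {m k : ℕ} {Z : Set V}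

/-- The weights of the walks from `Z` to `x`. -/
def walkWeights (H : SimpleGraph V) (w : V → ℕ) (Z : Set V) (x : V) : Set ℕ :=
  {b | ∃ z ∈ Z, ∃ p : H.Walk z x, walkWeight w p = b}

/-- The state of a shortest-path computation with sources `Z` and cap `m` after `k` rounds. -/
structure IsEstimate (H : SimpleGraph V) (w : V → ℕ) (m : ℕ) (Z : Set V) (k : ℕ) (D : V → ℕ) :
    Prop where
  le : ∀ x, D x ≤ m
  mem : ∀ x, D x ∈ insert m (walkWeights H w Z x)
  le_walkWeight : ∀ z ∈ Z, ∀ x, ∀ p : H.Walk z x, p.length ≤ k → D x ≤ walkWeight w p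

theorem isEstimate_zero (hw : ∀ x, w x ≤ m) (hZ : ∀ x ∈ Z, D x = w x) (hD : ∀ x ∉ Z, D x = m) :
    IsEstimate H w m Z 0 D where
  le x := by
    by_cases hx : x ∈ Z
    exacts [(hZ x hx).trans_le (hw x), (hD x hx).le]
  mem x := by
    by_cases hx : x ∈ Z
    exacts [Or.inr ⟨x, hx, .nil, by simp [hZ x hx]⟩, Or.inl (hD x hx)]
  le_walkWeight z hz x p hp := by
    obtain rfl := Walk.eq_of_length_eq_zero (Nat.le_zero.1 hp)
    exact (hZ z hz).trans_le (le_walkWeight_of_mem p p.start_mem_support)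

theorem IsEstimate.update [DecidableEq V] (h : IsEstimate H w m Z k D) {u v : V} (huv : H.Adj u v)
    (hlt : D u + w v < D v) : IsEstimate H w m Z k (Function.update D v (D u + w v)) where
  le x := by
    rw [Function.update_apply]
    split_ifs
    exacts [hlt.le.trans (h.le v), h.le x]
  mem x := by
    rw [Function.update_apply]
    split_ifs with hx
    · subst hx
      obtain ⟨z, hz, p, hp⟩ := (h.mem u).resolve_left (by have := h.le x; omega)
      exact Or.inr ⟨z, hz, p.concat huv, by rw [walkWeight_concat, hp]⟩
    · exact h.mem x
  le_walkWeight z hz x p hp := by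
    rw [Function.update_apply]
    split_ifs with hx
    · subst hx; exact hlt.le.trans (h.le_walkWeight z hz x p hp)
    · exact h.le_walkWeight z hz x p hp

theorem IsEstimate.succ (h : IsEstimate H w m Z k D) (h' : IsEstimate H w m Z k D')
    (hrelax : ∀ u v, H.Adj u v → D' v ≤ D u + w v) : IsEstimate H w m Z (k + 1) D' where
  le := h'.le
  mem := h'.mem
  le_walkWeight z hz x p hp := by
    cases p with
    | nil => exact h'.le_walkWeight z hz z .nil k.zero_le
    | cons hadj p =>
      obtain ⟨y, q, hyx, hq⟩ := Walk.exists_cons_eq_concat hadj p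
      rw [hq] at hp ⊢
      rw [Walk.length_concat, Nat.succ_le_succ_iff] at hp
      rw [walkWeight_concat]
      exact (hrelax y x hyx).trans (Nat.add_le_add_right (h.le_walkWeight z hz y q hp) _)

theorem IsEstimate.isLeast [Fintype V] (h : IsEstimate H w m Z k D)
    (hk : Fintype.card V ≤ k) (x : V) : IsLeast (insert m (walkWeights H w Z x)) (D x) := by
  classical
  refine ⟨h.mem x, ?_⟩
  rintro b (rfl | ⟨z, hz, p, rfl⟩)
  · exact h.le x
  · exact (h.le_walkWeight z hz x p.bypass (p.bypass_isPath.length_lt.le.trans hk)).trans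
      (walkWeight_bypass_le p)

theorem lt_min_iff_mem_ball [Fintype V] {d b : ℕ} {S : Finset V} {x : V}
    (hm : Fintype.card V < m) (hb : IsLeast (insert m (walkWeights H (fun _ => 1) S x)) b) :
    b < min m (d + 2) ↔ x ∈ ball H d S := by
  classical
  rw [mem_ball, lt_min_iff]
  constructor
  · rintro ⟨hlt, hbd⟩
    obtain ⟨a, ha, p, hp⟩ := hb.1.resolve_left hlt.ne
    rw [walkWeight_one] at hp
    exact ⟨a, ha, p, by omega⟩
  · rintro ⟨a, ha, p, hp⟩
    have hle := hb.2 (Or.inr ⟨a, ha, p.bypass, rfl⟩)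
    rw [walkWeight_one] at hle
    have := p.length_bypass_le_length
    have := p.bypass_isPath.length_lt
    omega

end Estimate

/-! ### Input and core -/

local notation "regCap" => 3
local notation "regRadius" => 4
local notation "regKind" => 5
local notation "regCount" => 6
local notation "regRound" => 7
local notation "regU" => 8
local notation "regV" => 9
local notation "regX" => 10
local notation "regY" => 11
local notation "regZ" => 12
local notation "regDeleted" => 13
local notation "regBest" => 14
local notation "regMin" => 15
local notation "regSavedY" => 16
local notation "regSavedDeleted" => 17
local notation "regStart" => 18
local notation "regPrev" => 19
local notation "regCur" => 20
local notation "regNext" => 21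

local notation "arrRow" => 3
local notation "arrCore" => 4
local notation "arrBranch" => 5
local notation "arrWeight" => 6
local notation "arrDist" => 7
local notation "arrCycle" => 8
local notation "arrHub" => 9

/-- The test that the vertices stored in registers `u` and `v` are adjacent. -/
def adjExpr (u v : ℕ) : Expr := .cell 0 (.add (.cell arrRow (.reg u)) (.reg v))

/-- A number larger than all weights of sets and walks that matter. -/
def cap (n : ℕ) : ℕ := n * n + 1

/-- The memory holds the input graph and the derived constants: array `arrRow` holds the offsets of
the rows of the adjacency matrix, register `regCap` the cap, and register `regRadius` the cap or
`d + 2`, whichever is smaller. -/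
structure HasInput {n : ℕ} (G : SimpleGraph (Fin n)) (d : ℕ) (s : Memory) : Prop where
  reg_zero : s.reg 0 = n
  reg_cap : s.reg regCap = cap n
  reg_radius : s.reg regRadius = min (cap n) (d + 2)
  adj : ∀ u v : Fin n, s.arr 0 (s.arr arrRow u + v) ≠ 0 ↔ G.Adj u v

/-- The program does not write to the part of the memory that `HasInput` refers to. -/
abbrev ForProgram.KeepsInput (P : ForProgram) : Prop :=
  (∀ r ∈ [0, regCap, regRadius], r ∉ P.regs) ∧ ∀ a ∈ [0, arrRow], a ∉ P.arrs

open ForProgram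

/-- Store the offsets of the rows of the adjacency matrix in `arrRow`. -/
def computeRows : ForProgram :=
  .forRange regU (.write arrRow (.add (.reg regU) (.const 1))
    (.add (.cell arrRow (.reg regU)) (.reg 0)))

/-- Compute the derived constants of `HasInput`. -/
def readInput : ForProgram :=
  .seq computeRows (.seq (.assign regCap (.add (.cell arrRow (.reg 0)) (.const 1)))
    (.assign regRadius (.sub (.reg regCap) (.sub (.reg regCap) (.add (.reg 1) (.const 2))))))

/-- Count the neighbours of vertex `regU` in the set `arrCore`. -/
def coreDegree : ForProgram :=
  .countIf regCount regV (.and (.cell arrCore (.reg regV)) (adjExpr regU regV))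

/-- Remove vertex `regU` from the set `arrCore` if it has fewer than two neighbours in this set. -/
def peelVertex : ForProgram :=
  .seq coreDegree
    (.ite (.lt (.reg regCount) (.const 2)) (.write arrCore (.reg regU) (.const 0)) .skip)

/-- Compute the largest set of minimum degree two in `arrCore`. -/
def peel : ForProgram :=
  .seq (.forRange regU (.write arrCore (.reg regU) (.const 1)))
    (.forRange regRound (.forRange regU peelVertex))

/-- Compute the branch vertices of the core, which get weight `n`, while all others get weight
`1`. -/
def branchWeights : ForProgram :=
  .forRange regU (.seq coreDegree (.ite
    (.and (.cell arrCore (.reg regU)) (.lt (.const 2) (.reg regCount)))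
    (.seq (.write arrBranch (.reg regU) (.const 1)) (.write arrWeight (.reg regU) (.reg 0)))
    (.seq (.write arrBranch (.reg regU) (.const 0)) (.write arrWeight (.reg regU) (.const 1)))))

section Core

variable {n d : ℕ} {G : SimpleGraph (Fin n)} {s s' : Memory}

theorem HasInput.frame {P : ForProgram} (h : HasInput G d s) (hF : P.Frame s s')
    (hP : P.KeepsInput := by decide) : HasInput G d s' where
  reg_zero := (hF.reg _ (hP.1 _ (by simp))).trans h.reg_zero
  reg_cap := (hF.reg _ (hP.1 _ (by simp))).trans h.reg_cap
  reg_radius := (hF.reg _ (hP.1 _ (by simp))).trans h.reg_radius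
  adj u v := by
    rw [hF.arr _ (hP.2 0 (by simp)), hF.arr _ (hP.2 arrRow (by simp))]
    exact h.adj u v

theorem HasInput.denote {P : ForProgram} (h : HasInput G d s) (hP : P.KeepsInput := by decide) :
    HasInput G d (P.denote s) :=
  h.frame (frame_denote P s) hP

theorem HasInput.holds_adjExpr (h : HasInput G d s) {u v : ℕ} {x y : Fin n} (hu : s.reg u = x)
    (hv : s.reg v = y) : (adjExpr u v).Holds s ↔ G.Adj x y := by
  simpa only [adjExpr, Expr.holds_cell, Expr.eval, hu, hv] using h.adj x y

theorem arr_inputMemory [DecidableRel G.Adj] (u v : Fin n) :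
    (inputMemory G d).arr 0 (u * n + v) ≠ 0 ↔ G.Adj u v := by
  simp only [inputMemory, true_and, ne_eq, ite_eq_right_iff, one_ne_zero, imp_false, not_not]
  refine ⟨?_, fun h => ⟨u, v, rfl, h⟩⟩
  rintro ⟨i, j, hij, hadj⟩
  have hpair : finProdFinEquiv (u, v) = finProdFinEquiv (i, j) := by
    ext
    simp only [finProdFinEquiv_apply_val]
    linarith
  obtain ⟨rfl, rfl⟩ := Prod.mk.inj (finProdFinEquiv.injective hpair)
  exact hadj

theorem arr_computeRows [DecidableRel G.Adj] :
    ∀ j ≤ n, (computeRows.denote (inputMemory G d)).arr arrRow j = j * n :=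
  forRange_induction (n := n) rfl (fun k s' => ∀ j ≤ k, s'.arr arrRow j = j * n)
    (fun _ _ _ h => h) (by simp [inputMemory]) fun x s' hF hx h j hj => by
      have h0 : s'.reg 0 = n := hF.reg 0 (by decide)
      simp only [ForProgram.denote, Expr.eval, arr_setCell, if_true, hx, Function.update_apply,
        h x le_rfl, h0]
      split_ifs with hjx
      · rw [hjx, add_mul, one_mul]
      · exact h j (by omega)

theorem hasInput_readInput [DecidableRel G.Adj] :
    HasInput G d (readInput.denote (inputMemory G d)) := by
  have hF := frame_denote computeRows (inputMemory G d)
  have h0 : (computeRows.denote (inputMemory G d)).reg 0 = n := hF.reg 0 (by decide)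
  have h1 : (computeRows.denote (inputMemory G d)).reg 1 = d := hF.reg 1 (by decide)
  have hrow := arr_computeRows (d := d) (G := G)
  refine ⟨h0, ?_, ?_, fun u v => ?_⟩
  · simp [readInput, ForProgram.denote, Expr.eval, h0, hrow, cap]
  · simp only [readInput, ForProgram.denote, Expr.eval, reg_setReg, h0, hrow n le_rfl]
    simp [h1, cap]
    omega
  · simp only [readInput, ForProgram.denote, arr_setReg, hF.arr 0 (by decide), hrow u u.2.le]
    exact arr_inputMemory u v

theorem reg_coreDegree [DecidableRel G.Adj] (hI : HasInput G d s) {x : Fin n}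
    (hx : s.reg regU = x) : (coreDegree.denote s).reg regCount =
      ({y | y ∈ mask n s arrCore ∧ G.Adj x y} : Finset (Fin n)).card :=
  reg_countIf hI.reg_zero (by decide) (by decide) _ fun y s' hF hy => by
    rw [Expr.holds_and, Expr.holds_cell, mem_mask, Expr.eval, hy, hF.arr arrCore (by decide),
      (hI.frame hF).holds_adjExpr ((hF.reg regU (by decide)).trans hx) hy]

theorem hasMinDegTwo_iff_card [DecidableRel G.Adj] {U : Finset (Fin n)} :
    HasMinDegTwo G U ↔ ∀ x ∈ U, 2 ≤ ({y | y ∈ U ∧ G.Adj x y} : Finset (Fin n)).card := by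
  refine forall₂_congr fun x _ => ?_
  rw [← Nat.lt_iff_add_one_le, Finset.one_lt_card]
  simp only [Finset.mem_filter_univ]
  constructor
  · rintro ⟨y, hy, z, hz, hyz, hxy, hxz⟩
    exact ⟨y, ⟨hy, hxy⟩, z, ⟨hz, hxz⟩, hyz⟩
  · rintro ⟨y, ⟨hy, hxy⟩, z, ⟨hz, hxz⟩, hyz⟩
    exact ⟨y, hy, z, hz, hyz, hxy, hxz⟩

theorem mask_peelVertex [DecidableRel G.Adj] (hI : HasInput G d s) {x : Fin n}
    (hx : s.reg regU = x) : mask n (peelVertex.denote s) arrCore =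
      if ({y | y ∈ mask n s arrCore ∧ G.Adj x y} : Finset (Fin n)).card < 2
        then (mask n s arrCore).erase x else mask n s arrCore := by
  have hcore := arr_denote (show arrCore ∉ coreDegree.arrs by decide) s
  have hU := reg_denote (show regU ∉ coreDegree.regs by decide) s
  simp only [peelVertex, ForProgram.denote, Expr.holds_lt, Expr.eval, reg_coreDegree hI hx, hU, hx]
  split_ifs
  · ext y
    simp [hcore, Function.update_apply, Fin.ext_iff]
  · simp only [mask, hcore]

theorem mask_peelRound [DecidableRel G.Adj] (hI : HasInput G d s) :
    let K := mask n ((forRange regU peelVertex).denote s) arrCore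
    K ⊆ mask n s arrCore ∧ (∀ U, HasMinDegTwo G U → U ⊆ mask n s arrCore → U ⊆ K) ∧
      ∀ x ∈ K, 2 ≤ ({y | y ∈ mask n s arrCore ∧ G.Adj x y} : Finset (Fin n)).card := by
  have h := forRange_induction hI.reg_zero (i := regU) (P := peelVertex)
    (fun k s' => mask n s' arrCore ⊆ mask n s arrCore ∧
      (∀ U, HasMinDegTwo G U → U ⊆ mask n s arrCore → U ⊆ mask n s' arrCore) ∧
      ∀ x : Fin n, x.val < k → x ∈ mask n s' arrCore →
        2 ≤ ({y | y ∈ mask n s arrCore ∧ G.Adj x y} : Finset (Fin n)).card)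
    (fun _ _ _ h => h) ⟨subset_rfl, fun _ _ h => h, by simp⟩ fun x s' hF hx ⟨hsub, hU, hdeg⟩ => by
      rw [mask_peelVertex (hI.frame hF) hx]
      split_ifs with hlt
      · refine ⟨(Finset.erase_subset _ _).trans hsub, fun U hdense hUs => ?_, fun y hy hmem => ?_⟩
        · refine Finset.subset_erase.2 ⟨hU U hdense hUs, fun hxU => hlt.not_ge ?_⟩
          refine (hasMinDegTwo_iff_card.1 hdense x hxU).trans (Finset.card_le_card ?_)
          exact Finset.monotone_filter_right _ fun z _ hz => ⟨hU U hdense hUs hz.1, hz.2⟩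
        · rw [Finset.mem_erase] at hmem
          exact hdeg y (by have := Fin.val_ne_of_ne hmem.1; omega) hmem.2
      · refine ⟨hsub, hU, fun y hy hmem => ?_⟩
        rcases Nat.lt_succ_iff_lt_or_eq.1 hy with hy | hy
        · exact hdeg y hy hmem
        · obtain rfl := Fin.ext hy
          exact (not_lt.1 hlt).trans (Finset.card_le_card
            (Finset.monotone_filter_right _ fun z _ hz => ⟨hsub hz.1, hz.2⟩))
  exact ⟨h.1, h.2.1, fun x => h.2.2 x x.2⟩

theorem isGreatest_peel (hI : HasInput G d s) :
    IsGreatest {U : Finset (Fin n) | HasMinDegTwo G U} (mask n (peel.denote s) arrCore) := by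
  classical
  set s₁ := (forRange regU (.write arrCore (.reg regU) (.const 1))).denote s
  have hI₁ : HasInput G d s₁ := hI.denote
  have hfull : mask n s₁ arrCore = Finset.univ :=
    mask_forRange hI.reg_zero _ fun _ _ _ _ => by simp [Expr.Holds, Expr.eval]
  have h := forRange_induction hI₁.reg_zero (i := regRound) (P := .forRange regU peelVertex)
    (fun k s' => (∀ U, HasMinDegTwo G U → U ⊆ mask n s' arrCore) ∧
      (HasMinDegTwo G (mask n s' arrCore) ∨ (mask n s' arrCore).card + k ≤ n))
    (fun _ _ _ h => h) ⟨fun U _ => by simp [hfull], by simp [hfull]⟩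
    fun x s' hF _ ⟨hU, hor⟩ => by
      obtain ⟨hsub, hU', hdeg⟩ := mask_peelRound (hI₁.frame hF)
      refine ⟨fun U hdense => hU' U hdense (hU U hdense), ?_⟩
      rcases hsub.eq_or_ssubset with heq | hss
      · exact Or.inl (hasMinDegTwo_iff_card.2 (by rwa [← heq] at hdeg))
      · have := Finset.card_lt_card hss
        refine Or.inr ?_
        rcases hor with hdense | hcard
        · exact absurd (hU' _ hdense subset_rfl) hss.not_subset
        · omega
  refine ⟨?_, fun U hdense => h.1 U hdense⟩
  rcases h.2 with hdense | hcard
  · exact hdense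
  · have : mask n (peel.denote s) arrCore = ∅ := Finset.card_eq_zero.1 (by
      have : (mask n (peel.denote s) arrCore).card + n ≤ n := hcard
      omega)
    simp [this, HasMinDegTwo]

/-- The weights computed from the core `K`: a cycle of minimum weight has as few branch vertices as
possible and, subject to this, minimum length. -/
def coreWeight (G : SimpleGraph (Fin n)) (K : Finset (Fin n))
    [DecidablePred (Branch (restrict G K))] (x : Fin n) : ℕ :=
  if Branch (restrict G K) x then n else 1

theorem branch_restrict_iff [DecidableRel G.Adj] {K : Finset (Fin n)} {x : Fin n} :
    Branch (restrict G K) x ↔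
      x ∈ K ∧ 2 < ({y | y ∈ K ∧ G.Adj x y} : Finset (Fin n)).card := by
  constructor
  · rintro ⟨Z, hZ, hadj⟩
    obtain ⟨z, hz⟩ := Finset.card_pos.1 (by omega : 0 < Z.card)
    refine ⟨(restrict_adj.1 (hadj z hz)).2.1, hZ.trans_le (Finset.card_le_card fun y hy => ?_)⟩
    obtain ⟨h, -, hyK⟩ := restrict_adj.1 (hadj y hy)
    exact (Finset.mem_filter_univ _).2 ⟨hyK, h⟩
  · rintro ⟨hx, hcard⟩
    refine ⟨_, hcard, fun y hy => ?_⟩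
    obtain ⟨hyK, hxy⟩ := (Finset.mem_filter_univ _).1 hy
    exact restrict_adj.2 ⟨hxy, hx, hyK⟩

theorem branchWeights_spec (hI : HasInput G d s)
    [DecidablePred (Branch (restrict G (mask n s arrCore)))] :
    (∀ x, x ∈ mask n (branchWeights.denote s) arrBranch ↔
        Branch (restrict G (mask n s arrCore)) x) ∧
      values n (branchWeights.denote s) arrWeight = coreWeight G (mask n s arrCore) := by
  classical
  have hstep {x : Fin n} {s' : Memory} (hF : branchWeights.Frame s s') (hx : s'.reg regU = x) :
      (Expr.and (.cell arrCore (.reg regU)) (.lt (.const 2) (.reg regCount))).Holds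
        (coreDegree.denote s') ↔ Branch (restrict G (mask n s arrCore)) x := by
    have hmask : mask n s' arrCore = mask n s arrCore := hF.mask_eq (by decide)
    rw [branch_restrict_iff, Expr.holds_and, Expr.holds_lt, Expr.holds_cell, Expr.eval, Expr.eval,
      Expr.eval, arr_denote (by decide), reg_denote (r := regU) (by decide), hx,
      reg_coreDegree (hI.frame hF) hx, ← mem_mask, hmask]
  have hbody {x : Fin n} {s' : Memory} (hF : branchWeights.Frame s s') (hx : s'.reg regU = x) :
      (coreDegree.denote s').reg regU = x ∧ (coreDegree.denote s').reg 0 = n ∧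
        (coreDegree.denote s').arr = s'.arr :=
    ⟨(reg_denote (by decide) s').trans hx,
      (reg_denote (by decide) s').trans (hI.frame hF).reg_zero,
      funext fun _ => arr_denote List.not_mem_nil s'⟩
  constructor
  · refine fun x => mem_mask.trans ?_
    refine cells_forRange hI.reg_zero (fun x v => v ≠ 0 ↔ Branch (restrict G (mask n s arrCore)) x)
      (fun x s' hF hx => ?_) x
    rw [ForProgram.denote, ForProgram.denote]
    split_ifs with h
    · exact ⟨1, by simpa using (hstep hF hx).1 h,
        by simp [ForProgram.denote, Expr.eval, hbody hF hx]⟩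
    · exact ⟨0, by simpa using mt (hstep hF hx).2 h,
        by simp [ForProgram.denote, Expr.eval, hbody hF hx]⟩
  · ext x
    refine cells_forRange hI.reg_zero (fun x v => v = coreWeight G (mask n s arrCore) x)
      (fun x s' hF hx => ⟨_, rfl, ?_⟩) x
    rw [ForProgram.denote, ForProgram.denote]
    simp only [coreWeight, ← hstep hF hx]
    split_ifs <;> simp [ForProgram.denote, Expr.eval, hbody hF hx]

end Core

/-! ### Distances and the minimum weight of a cycle -/

/-- Relax the estimate in `arrDist` along the edge from `regU` to `regV`. -/
def relaxEdge : ForProgram :=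
  .ite (.and (adjExpr regU regV)
      (.lt (.add (.cell arrDist (.reg regU)) (.cell arrWeight (.reg regV)))
        (.cell arrDist (.reg regV))))
    (.write arrDist (.reg regV) (.add (.cell arrDist (.reg regU)) (.cell arrWeight (.reg regV))))
    .skip

/-- Compute in `arrDist` the capped minimum weights, with respect to `arrWeight`, of walks from the
vertices that pass the test `e` on register `regU`, by the Bellman–Ford algorithm. -/
def distances (e : Expr) : ForProgram :=
  .seq (.forRange regU (.ite e (.write arrDist (.reg regU) (.cell arrWeight (.reg regU)))
      (.write arrDist (.reg regU) (.reg regCap))))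
    (.forRange regRound (.forRange regU (.forRange regV relaxEdge)))

section Distances

variable {n d m k : ℕ} {G : SimpleGraph (Fin n)} {w : Fin n → ℕ} {Z : Set (Fin n)} {s s' : Memory}

theorem isEstimate_relaxEdge (hI : HasInput G d s) (hw : values n s arrWeight = w) {u v : Fin n}
    (hu : s.reg regU = u) (hv : s.reg regV = v) (h : IsEstimate G w m Z k (values n s arrDist)) :
    let D := values n (relaxEdge.denote s) arrDist
    IsEstimate G w m Z k D ∧ D ≤ values n s arrDist ∧
      (G.Adj u v → D v ≤ values n s arrDist u + w v) := by
  have hwv : s.arr arrWeight v = w v := congrFun hw v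
  rw [relaxEdge, ForProgram.denote]
  split_ifs with hlt <;>
    simp only [Expr.holds_and, hI.holds_adjExpr hu hv, Expr.holds_lt, Expr.eval, hu, hv, hwv] at hlt
  · simp only [ForProgram.denote, Expr.eval, hu, hv, hwv, values_setCell]
    refine ⟨h.update hlt.1 hlt.2, update_le_self_iff.2 hlt.2.le, fun _ => ?_⟩
    rw [Function.update_self]
    rfl
  · exact ⟨h, le_rfl, fun huv => not_lt.1 fun hlt' => hlt ⟨huv, hlt'⟩⟩

theorem isEstimate_relaxVertex (hI : HasInput G d s) (hw : values n s arrWeight = w) {u : Fin n}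
    (hu : s.reg regU = u) (h : IsEstimate G w m Z k (values n s arrDist)) :
    let D := values n ((forRange regV relaxEdge).denote s) arrDist
    IsEstimate G w m Z k D ∧ D ≤ values n s arrDist ∧
      ∀ v, G.Adj u v → D v ≤ values n s arrDist u + w v := by
  have h := forRange_induction (i := regV) (P := relaxEdge) hI.reg_zero
    (fun j s' => IsEstimate G w m Z k (values n s' arrDist) ∧
      values n s' arrDist ≤ values n s arrDist ∧
      ∀ v : Fin n, v.val < j → G.Adj u v → values n s' arrDist v ≤ values n s arrDist u + w v)
    (fun _ _ _ h => h) ⟨h, le_rfl, by simp⟩ fun x s' hF hx ⟨hest, hle, hrelax⟩ => by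
      obtain ⟨hest', hle', hrelax'⟩ := isEstimate_relaxEdge (hI.frame hF)
        ((hF.values_eq (by decide)).trans hw) ((hF.reg regU (by decide)).trans hu) hx hest
      refine ⟨hest', hle'.trans hle, fun v hv huv => ?_⟩
      rcases Nat.lt_succ_iff_lt_or_eq.1 hv with hv | hv
      · exact (hle' v).trans (hrelax v hv huv)
      · obtain rfl := Fin.ext hv
        exact (hrelax' huv).trans (Nat.add_le_add_right (hle u) _)
  exact ⟨h.1, h.2.1, fun v => h.2.2 v v.2⟩

theorem isEstimate_relaxRound (hI : HasInput G d s) (hw : values n s arrWeight = w)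
    (h : IsEstimate G w m Z k (values n s arrDist)) : IsEstimate G w m Z (k + 1)
      (values n ((forRange regU (forRange regV relaxEdge)).denote s) arrDist) := by
  have h' := forRange_induction (i := regU) (P := forRange regV relaxEdge) hI.reg_zero
    (fun j s' => IsEstimate G w m Z k (values n s' arrDist) ∧
      values n s' arrDist ≤ values n s arrDist ∧
      ∀ u : Fin n, u.val < j → ∀ v, G.Adj u v →
        values n s' arrDist v ≤ values n s arrDist u + w v)
    (fun _ _ _ h => h) ⟨h, le_rfl, by simp⟩ fun x s' hF hx ⟨hest, hle, hrelax⟩ => by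
      obtain ⟨hest', hle', hrelax'⟩ := isEstimate_relaxVertex (hI.frame hF)
        ((hF.values_eq (by decide)).trans hw) hx hest
      refine ⟨hest', hle'.trans hle, fun u hu v huv => ?_⟩
      rcases Nat.lt_succ_iff_lt_or_eq.1 hu with hu | hu
      · exact (hle' v).trans (hrelax u hu v huv)
      · obtain rfl := Fin.ext hu
        exact (hrelax' v huv).trans (Nat.add_le_add_right (hle u) _)
  exact h.succ h'.1 fun u v => h'.2.2 u u.2 v

theorem isLeast_distances (hI : HasInput G d s) (hw : values n s arrWeight = w)
    (hwm : ∀ x, w x ≤ cap n) {e : Expr}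
    (hZ : ∀ (x : Fin n) (s' : Memory), (distances e).Frame s s' → s'.reg regU = x →
      (e.Holds s' ↔ x ∈ Z)) (x : Fin n) :
    IsLeast (insert (cap n) (walkWeights G w Z x)) (((distances e).denote s).arr arrDist x) := by
  classical
  rw [distances, ForProgram.denote]
  set P := forRange regU (.ite e (.write arrDist (.reg regU) (.cell arrWeight (.reg regU)))
      (.write arrDist (.reg regU) (.reg regCap))) with hP
  have hI₁ : HasInput G d (P.denote s) := hI.denote (by simp [KeepsInput, hP, regs, arrs])
  have hw₁ : values n (P.denote s) arrWeight = w :=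
    ((frame_denote P s).values_eq (by simp [hP, arrs])).trans hw
  have hinit := cells_forRange (P := .ite e
      (.write arrDist (.reg regU) (.cell arrWeight (.reg regU)))
      (.write arrDist (.reg regU) (.reg regCap))) (i := regU) (a := arrDist) hI.reg_zero
    (fun x v => v = if x ∈ Z then w x else cap n) fun x s' hF hx => ⟨_, rfl, by
      have hcap := (hF.reg regCap (by simp [regs])).trans hI.reg_cap
      have hwx : s'.arr arrWeight x = w x :=
        congrFun ((hF.values_eq (by simp [arrs])).trans hw) x
      have hxZ := hZ x s' (hF.mono (by simp [distances, regs]) (by simp [distances, arrs])) hx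
      simp only [ForProgram.denote, hxZ]
      split_ifs <;> simp [Expr.eval, hx, hcap, hwx]⟩
  have h := forRange_induction (i := regRound) (P := forRange regU (forRange regV relaxEdge))
    hI₁.reg_zero (fun k s' => IsEstimate G w (cap n) Z k (values n s' arrDist)) (fun _ _ _ h => h)
    (isEstimate_zero hwm (fun x hx => (hinit x).trans (if_pos hx))
      fun x hx => (hinit x).trans (if_neg hx))
    fun x s' hF _ hest =>
      isEstimate_relaxRound (hI₁.frame hF) ((hF.values_eq (by decide)).trans hw₁) hest
  exact h.isLeast (Fintype.card_fin n).le x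

end Distances

/-- Lower `regBest` to the weight of a cycle through `regX`, `regY` and `regZ`: the weight of `regY`
is in `regSavedY`, and `arrDist` holds the distances from `regX`. -/
def closeCycle : ForProgram :=
  .ite (.and (.and (adjExpr regY regZ) (.ne (.reg regX) (.reg regZ)))
      (.lt (.add (.reg regSavedY) (.cell arrDist (.reg regZ))) (.reg regBest)))
    (.assign regBest (.add (.reg regSavedY) (.cell arrDist (.reg regZ)))) .skip

/-- Lower `regBest` to the weights of the cycles through `regX` and `regY`, provided that
`arrWeight` holds the cap for `regY`. -/
def girthFrom : ForProgram :=
  .seq (distances (.not (.ne (.reg regU) (.reg regX)))) (.forRange regZ closeCycle)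

/-- Raise the weight of the vertex in register `v` to the cap, saving the old value in register
`r`. -/
def hideVertex (v r : ℕ) : ForProgram :=
  .seq (.assign r (.cell arrWeight (.reg v))) (.write arrWeight (.reg v) (.reg regCap))

/-- Lower `regBest` to the weights of the cycles through `regY`. -/
def girthAt : ForProgram :=
  .seq (.seq (hideVertex regY regSavedY)
      (.forRange regX (.ite (adjExpr regY regX) girthFrom .skip)))
    (.write arrWeight (.reg regY) (.reg regSavedY))

/-- Compute in `regBest` the capped minimum weight of a cycle, with respect to `arrWeight`. -/
def girth : ForProgram := .seq (.assign regBest (.reg regCap)) (.forRange regY girthAt)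

section Girth

variable {n d : ℕ} {G : SimpleGraph (Fin n)} {w : Fin n → ℕ} {s s' : Memory}

theorem isLeast_insert_image_add {a b m D : ℕ} {S : Set ℕ} (hbm : b ≤ m)
    (hD : IsLeast (insert m S) D) :
    IsLeast (insert b ((a + ·) '' S)) (if a + D < b then a + D else b) := by
  split_ifs with h
  · refine ⟨Or.inr ⟨D, hD.1.resolve_left (by omega), rfl⟩, ?_⟩
    rintro _ (rfl | ⟨x, hx, rfl⟩)
    · exact h.le
    · exact Nat.add_le_add_left (hD.2 (Or.inr hx)) a
  · refine ⟨Or.inl rfl, ?_⟩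
    rintro _ (rfl | ⟨x, hx, rfl⟩)
    · exact le_rfl
    · exact (not_lt.1 h).trans (Nat.add_le_add_left (hD.2 (Or.inr hx)) a)

theorem isLeast_closeCycle (hI : HasInput G d s) {x y z : Fin n} (hx : s.reg regX = x)
    (hy : s.reg regY = y) (hz : s.reg regZ = z) (hb : s.reg regBest ≤ cap n)
    (hD : IsLeast (insert (cap n) (walkWeights G w {x} z)) (s.arr arrDist z)) :
    IsLeast (insert (s.reg regBest) {b | G.Adj y z ∧ x ≠ z ∧
      ∃ p : G.Walk x z, s.reg regSavedY + walkWeight w p = b})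
      ((closeCycle.denote s).reg regBest) := by
  have hmin := isLeast_insert_image_add (a := s.reg regSavedY) hb hD
  rw [closeCycle, ForProgram.denote]
  split_ifs with h <;>
    simp only [Expr.holds_and, hI.holds_adjExpr hy hz, Expr.holds_ne, Expr.holds_lt, Expr.eval,
      hx, hz, ne_eq, Fin.val_inj] at h
  · rw [if_pos h.2] at hmin
    simpa [ForProgram.denote, Expr.eval, hz, h.1, walkWeights, Set.image] using hmin
  · by_cases hyz : G.Adj y z ∧ ¬x = z
    · rw [if_neg fun hlt => h ⟨hyz, hlt⟩] at hmin
      simpa [ForProgram.denote, hyz, walkWeights, Set.image] using hmin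
    · simp [ForProgram.denote, ← and_assoc, hyz]

theorem isLeast_girthFrom (hI : HasInput G d s) (hw : values n s arrWeight = w)
    (hwm : ∀ x, w x ≤ cap n) {x y : Fin n} (hx : s.reg regX = x) (hy : s.reg regY = y)
    (hb : s.reg regBest ≤ cap n) :
    IsLeast (insert (s.reg regBest) {b | ∃ z, G.Adj y z ∧ x ≠ z ∧
      ∃ p : G.Walk x z, s.reg regSavedY + walkWeight w p = b})
      ((girthFrom.denote s).reg regBest) := by
  have hF₁ := frame_denote (distances (.not (.ne (.reg regU) (.reg regX)))) s
  have hdist := isLeast_distances hI hw hwm (Z := {x})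
    (e := .not (.ne (.reg regU) (.reg regX))) fun u s' hF hu => by
      have hx' := (hF.reg regX (by decide)).trans hx
      simp [Expr.eval, hu, hx', Fin.ext_iff]
  rw [girthFrom, ForProgram.denote]
  set s₁ := (distances (.not (.ne (.reg regU) (.reg regX)))).denote s
  have h := (isLeast_forRange (hI.frame hF₁).reg_zero (i := regZ) (P := closeCycle) (r := regBest)
    (by decide) (fun s' => s'.arr arrDist = s₁.arr arrDist) (fun _ _ h => h) rfl
    (fun z => {b | G.Adj y z ∧ x ≠ z ∧
      ∃ p : G.Walk x z, s.reg regSavedY + walkWeight w p = b}) fun z s' hF hz hD hle => ?_).2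
  · rw [hF₁.reg regBest (by decide)] at h
    convert h using 2
    exact Set.ext fun b => by simp
  · have hF' : girthFrom.Frame s s' :=
      (hF₁.mono (by decide) (by decide)).trans (hF.mono (by decide) (by decide))
    refine ⟨(arr_denote (by decide) s').trans hD, ?_⟩
    rw [← hF'.reg regSavedY (by decide)]
    exact isLeast_closeCycle (hI.frame hF') ((hF'.reg regX (by decide)).trans hx)
      ((hF'.reg regY (by decide)).trans hy) hz
      (hle.trans ((hF₁.reg regBest (by decide)).trans_le hb)) (hD ▸ hdist z)

theorem isLeast_forRange_girthFrom (hI : HasInput G d s) {y : Fin n} (hy : s.reg regY = y)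
    (hsaved : s.reg regSavedY = w y)
    (hw : values n s arrWeight = Function.update w y (cap n)) (hwm : ∀ x, w x ≤ cap n)
    (hb : s.reg regBest ≤ cap n) :
    IsLeast (insert (s.reg regBest) (returnWeights G w (cap n) y))
      (((forRange regX (.ite (adjExpr regY regX) girthFrom .skip)).denote s).reg regBest) := by
  have h := (isLeast_forRange hI.reg_zero (i := regX) (r := regBest)
    (P := .ite (adjExpr regY regX) girthFrom .skip)
    (by decide) (fun _ => True) (fun _ _ h => h) trivial
    (fun x => {b | G.Adj y x ∧ ∃ z, G.Adj y z ∧ x ≠ z ∧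
      ∃ p : G.Walk x z, w y + walkWeight (Function.update w y (cap n)) p = b})
      fun x s' hF hx _ hle => ⟨trivial, ?_⟩).2
  · convert h using 2
    exact Set.ext fun b => by simp [returnWeights]
  · have hy' := (hF.reg regY (by decide)).trans hy
    rw [ForProgram.denote]
    split_ifs with hyx <;> rw [(hI.frame hF).holds_adjExpr hy' hx] at hyx
    · rw [← hsaved, ← hF.reg regSavedY (by decide)]
      simp only [hyx, true_and]
      refine isLeast_girthFrom (hI.frame hF) ((hF.values_eq (by decide)).trans hw) (fun u => ?_)
        hx hy' (hle.trans hb)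
      rw [Function.update_apply]
      split_ifs
      exacts [le_rfl, hwm u]
    · simp [hyx, ForProgram.denote]

theorem hideVertex_spec (hI : HasInput G d s) {v r : ℕ} {x : Fin n} (hx : s.reg v = x)
    (hvr : v ≠ r) (hr : regCap ≠ r) :
    ((hideVertex v r).denote s).reg r = values n s arrWeight x ∧
      values n ((hideVertex v r).denote s) arrWeight =
        Function.update (values n s arrWeight) x (cap n) := by
  simp only [hideVertex, ForProgram.denote, Expr.eval, reg_setReg, if_neg hvr, if_neg hr, hx,
    hI.reg_cap, values_setCell]
  exact ⟨by simp [values], rfl⟩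

theorem isLeast_girthAt (hI : HasInput G d s) (hw : values n s arrWeight = w)
    (hwm : ∀ x, w x ≤ cap n) {y : Fin n} (hy : s.reg regY = y) (hb : s.reg regBest ≤ cap n) :
    values n (girthAt.denote s) arrWeight = w ∧
      IsLeast (insert (s.reg regBest) (returnWeights G w (cap n) y))
        ((girthAt.denote s).reg regBest) := by
  obtain ⟨hsaved, hw₁⟩ := hideVertex_spec hI hy (r := regSavedY) (by decide) (by decide)
  have hy₁ : ((hideVertex regY regSavedY).denote s).reg regY = y :=
    (reg_denote (by decide) s).trans hy
  rw [hw] at hsaved hw₁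
  have hbest := isLeast_forRange_girthFrom hI.denote hy₁ hsaved hw₁ hwm
    ((reg_denote (by decide) s).trans_le hb)
  rw [reg_denote (r := regBest) (P := hideVertex _ _) (by decide)] at hbest
  refine ⟨?_, hbest⟩
  rw [girthAt, ForProgram.denote, ForProgram.denote, ForProgram.denote, Expr.eval, Expr.eval,
    reg_denote (r := regY) (by decide), hy₁, reg_denote (r := regSavedY) (by decide), hsaved,
    values_setCell, (frame_denote _ _).values_eq (by decide), hw₁]
  simp

theorem isLeast_girth (hI : HasInput G d s) (hw : values n s arrWeight = w)
    (hwm : ∀ x, w x ≤ cap n) : values n (girth.denote s) arrWeight = w ∧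
      IsLeast (insert (cap n) (cycleWeights G w)) ((girth.denote s).reg regBest) := by
  set s₁ := (ForProgram.assign regBest (.reg regCap)).denote s
  have hI₁ : HasInput G d s₁ := hI.denote
  have hbest : s₁.reg regBest = cap n := (reg_setReg _ _ _ _).trans hI.reg_cap
  have h := isLeast_forRange hI₁.reg_zero (i := regY) (r := regBest) (P := girthAt) (by decide)
    (fun s' => values n s' arrWeight = w) (fun _ _ h => h) hw
    (returnWeights G w (cap n)) fun y s' hF hy hw' hle =>
      isLeast_girthAt (hI₁.frame hF) hw' hwm hy (hle.trans hbest.le)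
  rw [hbest] at h
  exact ⟨h.1, isLeast_cycleWeights h.2⟩

end Girth

/-! ### Extracting a lightest cycle -/

/-- Raise the weight of `regDeleted` to the cap unless this raises the minimum weight of a cycle
above `regMin`. -/
def thinAt : ForProgram :=
  .seq (.seq (hideVertex regDeleted regSavedDeleted) girth) (.ite (.lt (.reg regMin) (.reg regBest))
    (.write arrWeight (.reg regDeleted) (.reg regSavedDeleted)) .skip)

/-- Raise the weights of all vertices outside one lightest cycle to the cap. -/
def thin : ForProgram :=
  .seq (.seq girth (.assign regMin (.reg regBest))) (.forRange regDeleted thinAt)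

section Thinning

variable {n d M : ℕ} {G : SimpleGraph (Fin n)} {w : Fin n → ℕ} {s s' : Memory}

theorem isThinning_thinAt (hI : HasInput G d s) (hwm : ∀ x, w x ≤ cap n) {S : Set (Fin n)}
    (h : IsThinning G w (cap n) M S (values n s arrWeight)) {x : Fin n}
    (hx : s.reg regDeleted = x) (hM : s.reg regMin = M) :
    IsThinning G w (cap n) M (insert x S) (values n (thinAt.denote s) arrWeight) := by
  have hle (y : Fin n) : values n s arrWeight y ≤ cap n := by
    rcases h.eq_or_eq y with hy | hy
    exacts [hy.trans_le (hwm y), hy.le]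
  obtain ⟨hsaved, hw₁⟩ := hideVertex_spec hI hx (r := regSavedDeleted) (by decide) (by decide)
  obtain ⟨hw₂, hbest⟩ := isLeast_girth (G := G) (d := d)
    (s := (hideVertex regDeleted regSavedDeleted).denote s) hI.denote hw₁ fun y => by
      rw [Function.update_apply]
      split_ifs
      exacts [le_rfl, hle y]
  rw [thinAt, ForProgram.denote]
  set s₂ := (ForProgram.seq (hideVertex regDeleted regSavedDeleted) girth).denote s with hs₂
  have hM₂ : s₂.reg regMin = M := (reg_denote (by decide) s).trans hM
  have hx₂ : s₂.reg regDeleted = x := (reg_denote (by decide) s).trans hx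
  have hsaved₂ : s₂.reg regSavedDeleted = values n s arrWeight x :=
    (reg_denote (P := girth) (by decide) _).trans hsaved
  rw [← ForProgram.denote, ← hs₂] at hw₂ hbest
  rw [ForProgram.denote]
  split_ifs with hlt <;> rw [Expr.holds_lt, Expr.eval, Expr.eval, hM₂] at hlt
  · rw [ForProgram.denote, Expr.eval, hx₂, Expr.eval, values_setCell, hsaved₂, hw₂,
      Function.update_idem, Function.update_eq_self]
    exact h.insert_of_lt hbest hlt
  · rw [ForProgram.denote, hw₂]
    exact h.update_of_le hle hbest (not_lt.1 hlt)

theorem isThinning_thin (hI : HasInput G d s) (hw : values n s arrWeight = w)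
    (hwm : ∀ x, w x ≤ cap n) : ∃ M, IsLeast (insert (cap n) (cycleWeights G w)) M ∧
      IsThinning G w (cap n) M Set.univ (values n (thin.denote s) arrWeight) := by
  obtain ⟨hw₁, hM⟩ := isLeast_girth hI hw hwm
  set M := (girth.denote s).reg regBest
  set s₁ := (ForProgram.seq girth (.assign regMin (.reg regBest))).denote s
  have hI₁ : HasInput G d s₁ := hI.denote
  have hM₁ : s₁.reg regMin = M := by simp [s₁, M, ForProgram.denote, Expr.eval]
  have h := forRange_induction (i := regDeleted) (P := thinAt) hI₁.reg_zero
    (fun k s' => IsThinning G w (cap n) M {x | x.val < k} (values n s' arrWeight))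
    (fun _ _ _ h => h) ⟨fun x => Or.inl (congrFun hw₁ x), ?_, by simp⟩ fun x s' hF hx h => ?_
  · refine ⟨M, hM, ?_⟩
    rwa [show {x : Fin n | x.val < n} = Set.univ by ext x; simp] at h
  · rw [show values n s₁ arrWeight = w from hw₁]
    exact hM
  · rw [show {y : Fin n | y.val < x.val + 1} = insert x {y : Fin n | y.val < x} by
      ext y; simp [le_iff_eq_or_lt, Fin.ext_iff]]
    exact isThinning_thinAt (hI₁.frame hF) hwm h hx ((hF.reg regMin (by decide)).trans hM₁)

end Thinning

/-- Find in `regNext` a neighbour of `regCur` in the set `arrCycle` other than `regPrev`. -/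
def findNext : ForProgram :=
  .findLast regNext regV (.and (.cell arrCycle (.reg regV))
    (.and (adjExpr regCur regV) (.ne (.reg regV) (.reg regPrev))))

/-- Move on to a vertex in the set `arrCycle` other than `regPrev` and append it to array `a`. -/
def stepAlong (a : ℕ) : ForProgram :=
  .seq findNext (.seq (.assign regPrev (.reg regCur)) (.seq (.assign regCur (.reg regNext))
    (.write a (.add (.reg regRound) (.const 1)) (.reg regCur))))

/-- Write to array `a` a nonbacktracking walk in the set `arrCycle`, starting at `regStart`. -/
def walkAlong (a : ℕ) : ForProgram :=
  .seq (.seq (.assign regPrev (.reg regStart)) (.seq (.assign regCur (.reg regStart))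
    (.write a (.const 0) (.reg regStart)))) (.forRange regRound (stepAlong a))

/-- Find in `regStart` a vertex of the set `arrCycle`. -/
def findStart : ForProgram := .findLast regStart regV (.cell arrCycle (.reg regV))

/-- List in array `a` a closed walk along the vertices of the set `arrCycle`, or nothing if this set
is empty. -/
def listCycle (a : ℕ) : ForProgram :=
  .seq (.countIf regCount regV (.cell arrCycle (.reg regV))) (.ite (.reg regCount)
    (.seq (.seq findStart (walkAlong a)) (.assign a (.add (.reg regCount) (.const 1))))
    (.assign a (.const 0)))

/-- Store in `arrCycle` the vertex set of a lightest cycle with respect to `arrWeight`, and list it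
in array `a`. -/
def lightestCycle (a : ℕ) : ForProgram :=
  .seq thin (.seq (.forRange regU
    (.write arrCycle (.reg regU) (.lt (.cell arrWeight (.reg regU)) (.reg regCap)))) (listCycle a))

/-- Array `a` lists a nonbacktracking walk of length `k` in `C`, whose last two vertices are in the
registers `regPrev` and `regCur`. -/
def TracesWalk {n : ℕ} (G : SimpleGraph (Fin n)) (C : Finset (Fin n)) (a k : ℕ) (s : Memory) :
    Prop :=
  ∃ f : ℕ → Fin n, IsNonbacktracking G C k f ∧ s.reg regPrev = f (k - 1) ∧ s.reg regCur = f k ∧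
    ∀ l ≤ k, s.arr a l = f l

section Listing

variable {n d a k : ℕ} {G : SimpleGraph (Fin n)} {w : Fin n → ℕ} {C : Finset (Fin n)} {s : Memory}

theorem exists_reg_findNext (hI : HasInput G d s) (hC : HasMinDegTwo G (mask n s arrCycle))
    {y z : Fin n} (hy : s.reg regPrev = y) (hz : s.reg regCur = z) (hzC : z ∈ mask n s arrCycle) :
    ∃ x, (x ∈ mask n s arrCycle ∧ G.Adj z x ∧ x ≠ y) ∧ (findNext.denote s).reg regNext = x := by
  refine exists_reg_findLast hI.reg_zero (by decide) _ (fun x s' hF hx => ?_)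
    (hC.exists_adj_ne y hzC)
  have hy' := (hF.reg regPrev (by decide)).trans hy
  have hz' := (hF.reg regCur (by decide)).trans hz
  simp [(hI.frame hF).holds_adjExpr hz' hx, Expr.eval, hx, hy', Fin.val_inj,
    hF.arr arrCycle (by decide)]

theorem TracesWalk.succ (hI : HasInput G d s) (hC : HasMinDegTwo G (mask n s arrCycle))
    (hk : s.reg regRound = k) (h : TracesWalk G (mask n s arrCycle) a k s) :
    TracesWalk G (mask n s arrCycle) a (k + 1) ((stepAlong a).denote s) := by
  obtain ⟨f, hf, hprev, hcur, hcells⟩ := h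
  obtain ⟨x, ⟨hx, hadj, hne⟩, hnext⟩ := exists_reg_findNext hI hC hprev hcur (hf.mem k le_rfl)
  have hcur' := (reg_denote (P := findNext) (r := regCur) (by decide) s).trans hcur
  have hk' := (reg_denote (P := findNext) (r := regRound) (by decide) s).trans hk
  refine ⟨_, hf.update hx hadj hne, ?_, ?_, fun l hl => ?_⟩ <;>
    simp only [stepAlong, ForProgram.denote, Expr.eval, reg_setReg, reg_setCell, arr_setCell,
      arr_setReg, if_true, if_false, Nat.reduceEqDiff]
  · simpa
  · simpa
  · rw [hnext, hk', Function.update_apply, Function.update_apply]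
    split_ifs with hlk
    · rfl
    · rw [arr_denote (P := findNext) (List.not_mem_nil)]
      exact hcells l (by omega)

theorem tracesWalk_walkAlong (hI : HasInput G d s) (ha : 0 < a) (ha' : a < 3)
    (hC : HasMinDegTwo G (mask n s arrCycle)) {x : Fin n} (hx : x ∈ mask n s arrCycle)
    (hstart : s.reg regStart = x) :
    TracesWalk G (mask n s arrCycle) a n ((walkAlong a).denote s) := by
  set s₁ := (ForProgram.seq (.assign regPrev (.reg regStart)) (.seq (.assign regCur (.reg regStart))
    (.write a (.const 0) (.reg regStart)))).denote s
  have hI₁ : HasInput G d s₁ :=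
    hI.denote ⟨by simp [regs], by simp [arrs]; omega⟩
  have hmask : mask n s₁ arrCycle = mask n s arrCycle :=
    (frame_denote _ s).mask_eq (by simp [arrs]; omega)
  rw [← hmask] at hC hx ⊢
  refine forRange_induction (i := regRound) (P := stepAlong a) hI₁.reg_zero
    (fun k s' => TracesWalk G (mask n s₁ arrCycle) a k s') (fun k s' v h => ?_) ?_
    fun x s' hF hx h => ?_
  · simpa [TracesWalk] using h
  · refine ⟨fun _ => x, ⟨fun _ _ => hx, by simp, by simp⟩, ?_⟩
    simp [s₁, ForProgram.denote, Expr.eval, hstart]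
  · have hmask' := hF.mask_eq (n := n) (a := arrCycle)
      (by simp [stepAlong, findNext, findLast, arrs]; omega)
    rw [← hmask'] at hC h ⊢
    refine h.succ (hI₁.frame hF ⟨by simp [stepAlong, findNext, findLast, regs],
      by simp [stepAlong, findNext, findLast, arrs]; omega⟩) hC hx

theorem TracesWalk.listsCycle (h : TracesWalk G C a n s) (hC : IsLightest G w C)
    (hw : ∀ x, 0 < w x) : ListsCycle G (setReg s a (C.card + 1)) a C := by
  obtain ⟨f, hf, -, -, hcells⟩ := h
  have hle : C.card ≤ n := card_finset_fin_le C
  obtain ⟨u, p, hp, hpC, hsupp⟩ := hC.exists_isCycle_of_isNonbacktracking hw (f := f)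
    ⟨fun l hl => hf.mem l (by omega), fun l hl => hf.adj l (by omega),
      fun l hl => hf.ne l (by omega)⟩
  refine ⟨u, p, hp, hpC, ?_⟩
  rw [hsupp, List.map_map, Memory.list, reg_setReg, if_pos rfl, arr_setReg]
  refine List.map_congr_left fun l hl => (hcells l ?_).symm
  rw [List.mem_range] at hl
  omega

theorem ListsCycle.reg_ne_zero (h : ListsCycle G s a C) : s.reg a ≠ 0 := by
  obtain ⟨u, p, -, -, hp⟩ := h
  intro h0
  simp [Memory.list, h0] at hp

theorem reg_count_cycle (hI : HasInput G d s) :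
    ((countIf regCount regV (.cell arrCycle (.reg regV))).denote s).reg regCount =
      (mask n s arrCycle).card := by
  rw [reg_countIf hI.reg_zero (by decide) (by decide) (· ∈ mask n s arrCycle) fun x s' hF hx => by
    simp [Expr.eval, hx, hF.arr arrCycle (by decide)]]
  simp [mask]

theorem exists_reg_findStart (hI : HasInput G d s) (hne : (mask n s arrCycle).Nonempty) :
    ∃ c ∈ mask n (findStart.denote s) arrCycle, (findStart.denote s).reg regStart = c := by
  rw [(frame_denote findStart s).mask_eq (by decide)]
  refine exists_reg_findLast hI.reg_zero (by decide) _ (fun x s' hF hx => ?_) hne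
  simp [Expr.eval, hx, hF.arr arrCycle (by decide)]

theorem reg_listCycle_of_eq_empty (hI : HasInput G d s) (h : mask n s arrCycle = ∅) :
    ((listCycle a).denote s).reg a = 0 := by
  have hcount := reg_count_cycle hI
  rw [h, Finset.card_empty] at hcount
  rw [listCycle, ForProgram.denote, ForProgram.denote, if_neg (by simp [hcount])]
  simp [ForProgram.denote, Expr.eval]

theorem listCycle_spec (hI : HasInput G d s) (ha : 0 < a) (ha' : a < 3)
    (hC : IsLightest G w (mask n s arrCycle)) (hw : ∀ x, 0 < w x) :
    ListsCycle G ((listCycle a).denote s) a (mask n s arrCycle) ∧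
      ∃ c ∈ mask n s arrCycle, ((listCycle a).denote s).reg regStart = c := by
  set s₁ := (countIf regCount regV (.cell arrCycle (.reg regV))).denote s with hs₁
  set s₂ := findStart.denote s₁ with hs₂
  have hI₂ : HasInput G d s₂ := HasInput.denote (s := s₁) hI.denote
  have hmask₁ : mask n s₁ arrCycle = mask n s arrCycle := (frame_denote _ s).mask_eq (by decide)
  have hmask : mask n s₂ arrCycle = mask n s arrCycle :=
    ((frame_denote findStart s₁).mask_eq (by decide)).trans hmask₁
  obtain ⟨c, hc, hstart⟩ := exists_reg_findStart (s := s₁) hI.denote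
    (hmask₁.symm ▸ hC.nonempty)
  have htrace := tracesWalk_walkAlong hI₂ ha ha' (hmask ▸ hC.hasMinDegTwo) hc hstart
  have hcount : ((walkAlong a).denote s₂).reg regCount = (mask n s arrCycle).card :=
    (reg_denote (by simp [walkAlong, stepAlong, findNext, findLast, regs]) s₂).trans
      ((reg_denote (by decide) s₁).trans (reg_count_cycle hI))
  have hne : (Expr.reg regCount).Holds s₁ := (reg_count_cycle hI).trans_ne hC.nonempty.card_ne_zero
  rw [listCycle, ForProgram.denote, ForProgram.denote, ← hs₁, if_pos hne, ForProgram.denote,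
    ForProgram.denote, ForProgram.denote, ← hs₂, Expr.eval, Expr.eval, Expr.eval, hcount]
  refine ⟨(hmask ▸ htrace).listsCycle hC hw, c, hmask ▸ hc, ?_⟩
  rw [reg_setReg, if_neg (by omega), ← hstart]
  exact reg_denote (by simp [walkAlong, stepAlong, findNext, findLast, regs]) s₂

theorem lightestCycle_spec (hI : HasInput G d s) (ha : 0 < a) (ha' : a < 3)
    (hw : values n s arrWeight = w) (hpos : ∀ x, 0 < w x) (hwm : ∀ x, w x ≤ cap n) :
    (mask n ((lightestCycle a).denote s) arrCycle = ∅ ∧ ((lightestCycle a).denote s).reg a = 0 ∧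
        ∀ U : Finset (Fin n), U.Nonempty → HasMinDegTwo G U → cap n ≤ ∑ x ∈ U, w x) ∨
      (IsLightest G w (mask n ((lightestCycle a).denote s) arrCycle) ∧
        ∑ x ∈ mask n ((lightestCycle a).denote s) arrCycle, w x < cap n ∧
        ListsCycle G ((lightestCycle a).denote s) a (mask n ((lightestCycle a).denote s) arrCycle) ∧
        ∃ c ∈ mask n ((lightestCycle a).denote s) arrCycle,
          ((lightestCycle a).denote s).reg regStart = c) := by
  obtain ⟨M, hM, hthin⟩ := isThinning_thin hI hw hwm
  set s₁ := thin.denote s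
  set s₂ := (forRange regU (.write arrCycle (.reg regU)
    (.lt (.cell arrWeight (.reg regU)) (.reg regCap)))).denote s₁
  have hI₁ : HasInput G d s₁ := hI.denote
  have hI₂ : HasInput G d s₂ := hI₁.denote
  have hmask₂ : mask n s₂ arrCycle =
      ({x | values n s₁ arrWeight x < cap n} : Finset (Fin n)) :=
    mask_forRange hI₁.reg_zero _ fun x s' hF hx => by
      rw [Finset.mem_filter_univ]
      simp [Expr.eval, hx, (hI₁.frame hF).reg_cap, hF.arr arrWeight (by decide), values]
  have hmask : mask n ((lightestCycle a).denote s) arrCycle = mask n s₂ arrCycle :=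
    (frame_denote (listCycle a) s₂).mask_eq (by
      simp [listCycle, countIf, findStart, walkAlong, stepAlong, findNext, findLast, arrs]; omega)
  rw [hmask]
  rcases hthin.isLightest hM with ⟨hempty, hcap⟩ | ⟨hC, hlt⟩
  · exact Or.inl ⟨hmask₂.trans hempty, reg_listCycle_of_eq_empty hI₂ (hmask₂.trans hempty), hcap⟩
  · rw [← hmask₂] at hC hlt
    exact Or.inr ⟨hC, hlt, listCycle_spec hI₂ ha ha' hC hpos⟩

end Listing

/-! ### The algorithm -/

/-- Compute in `arrDist` the capped distances, increased by one, from the set in array `a`. -/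
def distancesFrom (a : ℕ) : ForProgram :=
  .seq (.forRange regU (.write arrWeight (.reg regU) (.const 1))) (distances (.cell a (.reg regU)))

/-- The test that vertex `regU` is at distance at most `d` from the set used in `distancesFrom`. -/
def nearExpr : Expr := .lt (.cell arrDist (.reg regU)) (.reg regRadius)

/-- Mark in `arrHub` the branch vertices of the first cycle and its vertex `regStart`. -/
def markHub : ForProgram :=
  .forRange regU (.write arrHub (.reg regU) (.and (.cell arrCycle (.reg regU))
    (.or (.cell arrBranch (.reg regU)) (.not (.ne (.reg regU) (.reg regStart))))))

/-- Find a lightest cycle in the core, list it in array `1`, and mark its hub. -/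
def firstCycle : ForProgram :=
  .seq readInput (.seq peel (.seq branchWeights (.seq (lightestCycle 1) markHub)))

/-- Give weight `cap n` to the vertices at distance at most `d` from the first cycle, and weight `1`
to all others. -/
def farWeights : ForProgram :=
  .seq (distancesFrom arrCycle) (.forRange regU (.ite nearExpr
    (.write arrWeight (.reg regU) (.reg regCap)) (.write arrWeight (.reg regU) (.const 1))))

/-- Find a shortest cycle at distance more than `d` from the first cycle, and list it in array
`2`. -/
def secondCycle : ForProgram := .seq farWeights (lightestCycle 2)

/-- Output the two cycles, or the vertices at distance at most `d` from the hub if there is no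
second cycle. -/
def output : ForProgram :=
  .ite (.reg 2) (.assign regKind (.const 1))
    (.seq (.seq (distancesFrom arrHub) (.collect 1 regU nearExpr)) (.assign regKind (.const 0)))

/-- The algorithm, with the kind of the output in register `regKind` instead of register `0`. -/
def mainProgram : ForProgram := .seq firstCycle (.seq secondCycle output)

/-- The whole algorithm. Register `0` bounds the loops, so it receives the kind of the output only
at the end. -/
def algorithm : Program := .seq mainProgram.compile (.assign 0 (.reg regKind))

section Algorithm

variable {n d : ℕ} {G : SimpleGraph (Fin n)} {w : Fin n → ℕ} {s : Memory}

theorem lt_cap (n : ℕ) : n < cap n := Nat.lt_succ_of_le (Nat.le_mul_self n)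

theorem holds_nearExpr_distancesFrom {a : ℕ} (hI : HasInput G d s)
    (ha : a ∉ [arrRow, arrWeight, arrDist]) {s' : Memory} {x : Fin n}
    (hdist : s'.arr arrDist = ((distancesFrom a).denote s).arr arrDist)
    (hradius : s'.reg regRadius = ((distancesFrom a).denote s).reg regRadius)
    (hx : s'.reg regU = x) : nearExpr.Holds s' ↔ x ∈ ball G d (mask n s a) := by
  set s₁ := (forRange regU (.write arrWeight (.reg regU) (.const 1))).denote s
  have hI₁ : HasInput G d s₁ := hI.denote
  have hweight : values n s₁ arrWeight = fun _ => 1 := funext fun y =>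
    cells_forRange hI.reg_zero (fun _ v => v = 1)
      (fun y s' _ hy => ⟨1, rfl, by simp [ForProgram.denote, Expr.eval, hy]⟩) y
  have hmask : mask n s₁ a = mask n s a := (frame_denote _ s).mask_eq (by simp_all [arrs])
  have h := isLeast_distances (e := .cell a (.reg regU)) hI₁ hweight
    (fun _ => (Nat.succ_pos _)) (Z := mask n s₁ a)
    (fun y s' hF hy => by
      rw [Expr.holds_cell, Expr.eval, hy, hF.arr a (by simp_all [distances, relaxEdge, arrs])]
      simp) x
  have hI₂ : HasInput G d ((distancesFrom a).denote s) := hI.denote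
    ⟨by simp [distancesFrom, distances, relaxEdge, regs],
      by simp [distancesFrom, distances, relaxEdge, arrs]⟩
  rw [hmask] at h
  rw [← lt_min_iff_mem_ball ((Fintype.card_fin n).trans_lt (lt_cap n)) h, nearExpr, Expr.holds_lt,
    Expr.eval, Expr.eval, Expr.eval, hx, hdist, hradius, hI₂.reg_radius]
  rfl

theorem notMem_of_sum_lt_cap {D S : Finset (Fin n)}
    (hD : ∑ x ∈ D, (if x ∈ S then cap n else 1) < cap n) {x : Fin n} (hx : x ∈ D) : x ∉ S := by
  intro hxS
  refine hD.not_ge (le_trans ?_ (Finset.single_le_sum (fun _ _ => Nat.zero_le _) hx))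
  rw [if_pos hxS]

theorem exists_mem_of_cap_le_sum {U S : Finset (Fin n)}
    (h : cap n ≤ ∑ x ∈ U, (if x ∈ S then cap n else 1)) : ∃ x ∈ U, x ∈ S := by
  by_contra! hU
  rw [Finset.sum_congr rfl fun x hx => if_neg (hU x hx), Finset.sum_const, smul_eq_mul,
    mul_one] at h
  exact (h.trans (card_finset_fin_le U)).not_gt (lt_cap n)

theorem values_farWeights (hI : HasInput G d s) :
    values n (farWeights.denote s) arrWeight =
      fun x => if x ∈ ball G d (mask n s arrCycle) then cap n else 1 := by
  set s₁ := (distancesFrom arrCycle).denote s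
  have hI₁ : HasInput G d s₁ := hI.denote
  refine funext fun x => cells_forRange hI₁.reg_zero
    (fun x v => v = if x ∈ ball G d (mask n s arrCycle) then cap n else 1)
    (fun x s' hF hx => ⟨_, rfl, ?_⟩) x
  have hnear := holds_nearExpr_distancesFrom hI (a := arrCycle) (by decide)
    (hF.arr arrDist (by decide)) (hF.reg regRadius (by decide)) hx
  simp only [ForProgram.denote, ← hnear]
  split_ifs <;> simp [Expr.eval, hx, (hI₁.frame hF).reg_cap]

theorem mask_markHub (hI : HasInput G d s) : mask n (markHub.denote s) arrHub =
    {x ∈ mask n s arrCycle | x ∈ mask n s arrBranch ∨ s.reg regStart = x} :=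
  mask_forRange hI.reg_zero _ fun x s' hF hx => by
    simp [Expr.eval, hx, hF.reg regStart (by decide), hF.arr arrCycle (by decide),
      hF.arr arrBranch (by decide), eq_comm]

theorem ListsCycle.denote {P : ForProgram} {a : ℕ} {C : Finset (Fin n)} (h : ListsCycle G s a C)
    (hr : a ∉ P.regs := by decide) (ha : a ∉ P.arrs := by decide) :
    ListsCycle G (P.denote s) a C := by
  simpa only [ListsCycle, Memory.list, reg_denote hr, arr_denote ha] using h

theorem OutputsSet.denote {P : ForProgram} {a : ℕ} {X : Finset (Fin n)} (h : OutputsSet s a X)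
    (hr : a ∉ P.regs := by decide) (ha : a ∉ P.arrs := by decide) :
    OutputsSet (P.denote s) a X := by
  simpa only [OutputsSet, Memory.list, reg_denote hr, arr_denote ha] using h

theorem coreWeight_pos {K : Finset (Fin n)} [DecidablePred (Branch (restrict G K))] (x : Fin n) :
    0 < coreWeight G K x := by
  rw [coreWeight]
  split_ifs
  exacts [x.pos, Nat.one_pos]

theorem coreWeight_le {K : Finset (Fin n)} [DecidablePred (Branch (restrict G K))] (x : Fin n) :
    coreWeight G K x ≤ n := by
  rw [coreWeight]
  split_ifs
  exacts [le_rfl, x.pos]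

open scoped Classical in
theorem firstCycle_spec [DecidableRel G.Adj] :
    let s := firstCycle.denote (inputMemory G d)
    HasInput G d s ∧
      ((mask n s arrHub = ∅ ∧ ∀ U : Finset (Fin n), U.Nonempty → ¬ HasMinDegTwo G U) ∨
        ∃ K, IsGreatest {U : Finset (Fin n) | HasMinDegTwo G U} K ∧
          IsLightest G (coreWeight G K) (mask n s arrCycle) ∧
          ListsCycle G s 1 (mask n s arrCycle) ∧ ∃ c₀ ∈ mask n s arrCycle,
            mask n s arrHub = {x ∈ mask n s arrCycle | Branch (restrict G K) x ∨ x = c₀}) := by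
  have hI₁ := hasInput_readInput (G := G) (d := d)
  set s₁ := readInput.denote (inputMemory G d)
  have hK := isGreatest_peel hI₁
  set s₂ := peel.denote s₁
  have hI₂ : HasInput G d s₂ := hI₁.denote
  obtain ⟨hbranch, hw⟩ := branchWeights_spec hI₂
  set K := mask n s₂ arrCore
  set s₃ := branchWeights.denote s₂
  have hI₃ : HasInput G d s₃ := hI₂.denote
  set s₄ := (lightestCycle 1).denote s₃
  have hI₄ : HasInput G d s₄ := hI₃.denote
  have hhub := mask_markHub hI₄
  have hbranch₄ : mask n s₄ arrBranch = mask n s₃ arrBranch :=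
    (frame_denote _ s₃).mask_eq (by decide)
  have hcycle : mask n (markHub.denote s₄) arrCycle = mask n s₄ arrCycle :=
    (frame_denote _ s₄).mask_eq (by decide)
  rw [show firstCycle.denote (inputMemory G d) = markHub.denote s₄ from rfl]
  refine ⟨hI₄.denote, ?_⟩
  rw [hhub, hcycle]
  rcases lightestCycle_spec (a := 1) hI₃ (by decide) (by decide) hw coreWeight_pos
      (fun x => (coreWeight_le x).trans (lt_cap n).le) with
    ⟨hempty, -, hcap⟩ | ⟨hC, -, hlists, c₀, hc₀, hstart⟩
  · refine Or.inl ⟨by rw [hempty, Finset.filter_empty], fun U hne hU => ?_⟩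
    refine (hcap U hne hU).not_gt (Nat.lt_succ_of_le ?_)
    calc ∑ x ∈ U, coreWeight G K x ≤ U.card * n :=
          Finset.sum_le_card_nsmul _ _ _ fun x _ => coreWeight_le x
      _ ≤ n * n := Nat.mul_le_mul_right _ (card_finset_fin_le U)
  · refine Or.inr ⟨K, hK, hC, hlists.denote, c₀, hc₀, Finset.filter_congr fun x _ => ?_⟩
    rw [hbranch₄, hstart, hbranch, Fin.val_inj, eq_comm]

theorem secondCycle_spec (hI : HasInput G d s) :
    (((secondCycle.denote s).reg 2 = 0 ∧ ∀ U : Finset (Fin n), U.Nonempty → HasMinDegTwo G U →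
        ∃ u ∈ U, u ∈ ball G d (mask n s arrCycle)) ∨
      ∃ D : Finset (Fin n), D.Nonempty ∧ HasMinDegTwo G D ∧
        ListsCycle G (secondCycle.denote s) 2 D ∧ ∀ x ∈ D, x ∉ ball G d (mask n s arrCycle)) := by
  rcases lightestCycle_spec (a := 2) (HasInput.denote hI) (by decide) (by decide)
      (values_farWeights hI)
      (fun x => by split_ifs; exacts [Nat.succ_pos _, Nat.one_pos])
      (fun x => by split_ifs; exacts [le_rfl, Nat.succ_pos _]) with
    ⟨-, hreg, hcap⟩ | ⟨hD, hlt, hlists, -⟩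
  · exact Or.inl ⟨hreg, fun U hne hU => exists_mem_of_cap_le_sum (hcap U hne hU)⟩
  · exact Or.inr ⟨_, hD.nonempty, hD.hasMinDegTwo, hlists, fun x => notMem_of_sum_lt_cap hlt⟩

theorem outputsFeedbackVertexSet_output {b : ℕ} (hI : HasInput G d s) (h2 : s.reg 2 = 0)
    (hcard : (ball G d (mask n s arrHub)).card ≤ b)
    (hX : IsFeedbackVertexSet G (ball G d (mask n s arrHub) : Set (Fin n))) :
    OutputsFeedbackVertexSet G b
      ((ForProgram.assign 0 (.reg regKind)).denote (output.denote s)) := by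
  set s₁ := (distancesFrom arrHub).denote s
  have hout : output.denote s = (ForProgram.assign regKind (.const 0)).denote
      ((collect 1 regU nearExpr).denote s₁) := if_neg (not_not.2 h2)
  rw [hout]
  refine ⟨rfl, _, hcard, hX, OutputsSet.denote (OutputsSet.denote ?_)⟩
  have hI₁ : HasInput G d s₁ := hI.denote
  exact outputsSet_collect hI₁.reg_zero (by decide) one_ne_zero _ fun x s' hF hx =>
    holds_nearExpr_distancesFrom hI (by decide) (hF.arr arrDist (by decide))
      (hF.reg regRadius (by decide)) hx

theorem outputsPacking_output {C D : Finset (Fin n)} (hC : ListsCycle G s 1 C)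
    (hD : ListsCycle G s 2 D) (hfar : ∀ x ∈ D, x ∉ ball G d C) :
    OutputsPacking G d ((ForProgram.assign 0 (.reg regKind)).denote (output.denote s)) := by
  have hout : output.denote s = (ForProgram.assign regKind (.const 1)).denote s :=
    if_pos hD.reg_ne_zero
  rw [hout]
  exact outputsPacking_of_listsCycle rfl hC.denote.denote hD.denote.denote hfar

open scoped Classical in
theorem mainProgram_spec [DecidableRel G.Adj] {t : ℕ} (hd : 0 < d) (ht : G.maxDegree ≤ t) :
    let s := (ForProgram.assign 0 (.reg regKind)).denote (mainProgram.denote (inputMemory G d))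
    OutputsPacking G d s ∨ OutputsFeedbackVertexSet G (17 * (d * t ^ (2 * d))) s := by
  obtain ⟨hI₁, hfirst⟩ := firstCycle_spec (G := G) (d := d)
  set s₁ := firstCycle.denote (inputMemory G d)
  have hI₂ : HasInput G d (secondCycle.denote s₁) := hI₁.denote
  have hhub : mask n (secondCycle.denote s₁) arrHub = mask n s₁ arrHub :=
    (frame_denote secondCycle s₁).mask_eq (by decide)
  rw [show mainProgram.denote (inputMemory G d) = output.denote (secondCycle.denote s₁) from rfl]
  rcases secondCycle_spec hI₁ with ⟨h2, hB⟩ | ⟨D, hne, hD, hlists, hfar⟩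
  · refine Or.inr (outputsFeedbackVertexSet_output hI₂ h2 ?_ ?_) <;> rw [hhub]
    · rcases hfirst with ⟨hempty, -⟩ | ⟨K, hK, hC, -, c₀, -, heq⟩
      · have hball : ball G d ∅ = ∅ := Finset.ext fun x => by simp
        simp [hempty, hball]
      · rw [heq]
        exact card_ball_le_of_isLightest hK hC (by simp [coreWeight]) hB c₀ hd ht
    · rcases hfirst with ⟨-, hno⟩ | ⟨K, hK, hC, -, c₀, hc₀, heq⟩
      · exact isFeedbackVertexSet_of_forall_inter fun U hU hdeg => absurd hdeg (hno U hU)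
      · rw [heq]
        exact isFeedbackVertexSet_ball hK hC coreWeight_pos hB hc₀
  · obtain ⟨-, -, -, hlists₁, -⟩ := hfirst.resolve_left fun h => h.2 D hne hD
    exact Or.inl (outputsPacking_output hlists₁.denote hlists hfar)

theorem runs_algorithm (s : Memory) :
    ∃ T, Runs algorithm s T
        ((ForProgram.assign 0 (.reg regKind)).denote (mainProgram.denote s)) ∧
      T ≤ (mainProgram.cost + Polynomial.C 2).eval (s.reg 0) := by
  obtain ⟨T, hT, hTle⟩ := mainProgram.runs_compile (by decide) (by decide) s
  refine ⟨_, .seq hT (.assign _ _ _), ?_⟩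
  rw [Polynomial.eval_add, Polynomial.eval_C]
  exact Nat.add_le_add_right hTle _

end Algorithm

end CoarseErdosPosa

open CoarseErdosPosa in
theorem corollary1p7 :
    ∃ (P : Program) (p : Polynomial ℕ) (c : ℕ),
      ∀ (d t : ℕ), 0 < d → 0 < t →
        ∀ (n : ℕ) (G : SimpleGraph (Fin n)) [DecidableRel G.Adj], G.maxDegree ≤ t →
          ∃ (T : ℕ) (s : Memory), Runs P (inputMemory G d) T s ∧ T ≤ p.eval n ∧
            (OutputsPacking G d s ∨ OutputsFeedbackVertexSet G (c * (d * t ^ (2 * d))) s) := by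
  refine ⟨algorithm, mainProgram.cost + Polynomial.C 2, 17, fun d t hd _ n G _ ht => ?_⟩
  obtain ⟨T, hT, hTle⟩ := runs_algorithm (inputMemory G d)
  exact ⟨T, _, hT, hTle, mainProgram_spec hd ht⟩
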